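/- Let $n\ge 2$ be even and let $k\ge 2$. Consider towers built from rectangular blocks of width $1$, height $1$ and length $n$, stacked in levels over the square $[0,n]\times[0,n]$: each level consists of $n$ parallel boxes of size $1\times n\times 1$, each of which is empty or filled by a block, and the direction of the boxes turns by $90^\circ$ from each level to the next. An $(n,k)$-configuration is such a tower with exactly $2k-1$ levels in which * the topmost level has $n/2$ blocks in consecutive boxes (no gaps), * the second level from the top has all $n$ blocks, * each of the remaining $2k-3$ levels has $n/2$ blocks, and between any two blocks of such a level there is at least one empty box. Let $Q$ be the boundary in $\mathbb R^3$ of the union of the blocks of an $(n,k)$-configuration. Then $Q$, divided into the unit squares of the integer lattice, is a connected polyhedral closed surface (finitely many convex polygons glued along vertices or edges, each edge lying in exactly two faces, and the link of each vertex being connected), and its genus $g(n,k)$, i.e. the number with $\#V(Q)-\#E(Q)+\#F(Q)=2\,(1-g(n,k))$, is $$g(n,k)=\frac{n(n-2)(k-2)}{2}.$$ -/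

import Mathlib

namespace Jenga

/-- Euclidean three-space. -/
abbrev E3 : Type := EuclideanSpace ℝ (Fin 3)

/-! ### Polyhedral closed surfaces in three-space

A polyhedron is given by the set of its faces, which are convex polygons; edges and vertices
are those of the faces. -/

/-- A (two-dimensional, compact) convex polygon in three-space. -/
def IsConvexPolygon (f : Set E3) : Prop :=
  (∃ s : Set E3, s.Finite ∧ f = convexHull ℝ s) ∧ Module.finrank ℝ (vectorSpan ℝ f) = 2

/-- The vertices of a convex polygon. -/
def polygonVertices (f : Set E3) : Set E3 := f.extremePoints ℝ

/-- The edges of a convex polygon: the nondegenerate segments that are extreme subsets of it. -/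
def polygonEdges (f : Set E3) : Set (Set E3) :=
  {e | ∃ a b : E3, a ≠ b ∧ e = segment ℝ a b ∧ IsExtreme ℝ f e}

/-- `V(X)` for the polyhedron `X` with set of faces `F`. -/
def vertices (F : Set (Set E3)) : Set E3 := {v | ∃ f ∈ F, v ∈ polygonVertices f}

/-- `E(X)` for the polyhedron `X` with set of faces `F`. -/
def edges (F : Set (Set E3)) : Set (Set E3) := {e | ∃ f ∈ F, e ∈ polygonEdges f}

/-- `F` is the set of faces of a polyhedron: finitely many convex polygons, glued along common
vertices or common edges. -/
structure IsPolyhedron (F : Set (Set E3)) : Prop where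
  finite : F.Finite
  polygon : ∀ f ∈ F, IsConvexPolygon f
  glue : ∀ f ∈ F, ∀ g ∈ F, f ≠ g →
    f ∩ g = ∅ ∨
    (∃ v, v ∈ polygonVertices f ∧ v ∈ polygonVertices g ∧ f ∩ g = {v}) ∨
    (f ∩ g ∈ polygonEdges f ∧ f ∩ g ∈ polygonEdges g)

/-- The link of `v`: the edges opposite to `v` in the faces that have `v` as a vertex.
(A vertex of a polygon lies on an edge of that polygon only as an endpoint.) -/
def link (F : Set (Set E3)) (v : E3) : Set (Set E3) :=
  {e | ∃ f ∈ F, e ∈ polygonEdges f ∧ v ∈ polygonVertices f ∧ v ∉ e}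

/-- Polyhedral closed surface: each edge is an edge of exactly two faces, and the link of each
vertex is connected. -/
structure IsPolyhedralClosedSurface (F : Set (Set E3)) : Prop extends IsPolyhedron F where
  two_faces : ∀ e ∈ edges F, {f | f ∈ F ∧ e ∈ polygonEdges f}.ncard = 2
  link_connected : ∀ v ∈ vertices F, IsConnected (⋃₀ link F v)

/-- The Euler characteristic `#V - #E + #F`. -/
noncomputable def eulerChar (F : Set (Set E3)) : ℤ :=
  ((vertices F).ncard : ℤ) - ((edges F).ncard : ℤ) + (F.ncard : ℤ)

/-- The genus of a connected polyhedral closed surface in three-space (such a surface is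
orientable): the number `g` with `#V - #E + #F = 2 * (1 - g)`. -/
noncomputable def genus (F : Set (Set E3)) : ℚ := 1 - (eulerChar F : ℚ) / 2

/-! ### Towers of blocks -/

/-- A configuration of blocks in box description: `numLevels` levels, counted from the bottom,
each of them with `n` boxes, and for each level the set of boxes that contain a block. -/
structure Configuration (n : ℕ) where
  numLevels : ℕ
  level : Fin numLevels → Finset (Fin n)

/-- The block in box `j` of level `s` of an `n`-column tower. It has width `1`, height `1` and
length `n`; it is parallel to the second axis if `s` is even and to the first axis if `s` is
odd. -/
def block (n s j : ℕ) : Set E3 :=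
  if Even s then
    {x | x 0 ∈ Set.Icc (j : ℝ) (j + 1) ∧ x 1 ∈ Set.Icc (0 : ℝ) n ∧
      x 2 ∈ Set.Icc (s : ℝ) (s + 1)}
  else
    {x | x 0 ∈ Set.Icc (0 : ℝ) n ∧ x 1 ∈ Set.Icc (j : ℝ) (j + 1) ∧
      x 2 ∈ Set.Icc (s : ℝ) (s + 1)}

/-- The union of all blocks of a configuration. -/
def Configuration.solid {n : ℕ} (c : Configuration n) : Set E3 :=
  ⋃ s : Fin c.numLevels, ⋃ j ∈ c.level s, block n s j

/-- The closed unit square of the integer lattice with lowest corner `p`, perpendicular to the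
`i`-th axis. -/
def unitSquare (p : Fin 3 → ℤ) (i : Fin 3) : Set E3 :=
  {x | x i = p i ∧ ∀ j, j ≠ i → x j ∈ Set.Icc (p j : ℝ) (p j + 1)}

/-- The polyhedral surface of a configuration: the boundary of the union of the blocks, with the
unit lattice squares that it contains as faces. -/
def Configuration.surface {n : ℕ} (c : Configuration n) : Set (Set E3) :=
  {f | (∃ p i, f = unitSquare p i) ∧ f ⊆ frontier c.solid}

/-- The blocks of a level are placed without gaps: they occupy consecutive boxes. -/
def WithoutGaps {n : ℕ} (A : Finset (Fin n)) : Prop := (A : Set (Fin n)).OrdConnected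

/-- The blocks of a level are separated: between any two of them there is at least one empty
box. -/
def Gapped {n : ℕ} (A : Finset (Fin n)) : Prop :=
  ∀ i ∈ A, ∀ j ∈ A, i < j → ∃ m, i < m ∧ m < j ∧ m ∉ A

/-- The `(n,k)`-configuration for even `n`: it has `2k - 1` levels; the topmost level has `n/2`
blocks without gaps, the second level from the top has `n` blocks, and each of the other
`2k - 3` levels has `n/2` blocks, with a gap between any two of them. -/
structure Configuration.IsEvenNK {n : ℕ} (c : Configuration n) (k : ℕ) : Prop where
  numLevels_eq : c.numLevels = 2 * k - 1
  top : ∀ s : Fin c.numLevels, (s : ℕ) + 1 = c.numLevels →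
    (c.level s).card = n / 2 ∧ WithoutGaps (c.level s)
  second : ∀ s : Fin c.numLevels, (s : ℕ) + 2 = c.numLevels → (c.level s).card = n
  rest : ∀ s : Fin c.numLevels, (s : ℕ) + 2 < c.numLevels →
    (c.level s).card = n / 2 ∧ Gapped (c.level s)

end Jenga

/-! Write r_z for the number of runs (maximal sets of consecutive filled boxes) in level z. A run is
a box, and since consecutive levels are turned by 90°, each run of level z meets each run of level
z-1 in exactly one rectangle. So the solid has Euler characteristic ∑ r_z - ∑ r_z r_{z-1}, and its
boundary has twice that. The 2k-3 gapped levels have n/2 runs each, the two upper levels one run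
each; with m = n/2 this gives χ = 2 + (2k-4)(2m - 2m²), which is the claimed genus.

The proof obtains the boundary formula by counting, without homology. The solid is cut into lattice
cubes, and the vertices, edges and faces of the surface are the lattice cells that are `Mixed`:
contained both in a cube of the solid and in a cube outside it. Each level is a product of two sets
of integers, so the mixed cells at a given height are counted by products of one-dimensional counts;
in the alternating sum the lengths cancel and only numbers of runs survive (`eulerChar_towerCubes`,
evaluated in `Configuration.IsEvenNK.eulerChar_surface`).

That the boundary is a closed surface is a local matter. The shadows of consecutive levels on each
axis are nested (`Nested`), since one of them is the whole interval [0,n). This forbids checkerboard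
patterns around an edge (`noDiagonal_towerCubes`, `ncard_faces_eq_two`) and disconnected patterns
around a vertex (`link_pattern`, `isConnected_link_towerCubes`). Connectedness of the boundary
(`isConnected_frontier_alternating`) holds because side walls of runs in consecutive levels always
cross in a point, and every other piece of the boundary is attached to a side wall of its own run.
-/

namespace Jenga

/-! ### Cells of the integer lattice -/

/-- The closed cell of the cubical lattice `ℤ³` with lowest corner `p` that extends by one unit in
the directions of `D`. -/
def cell (p : Fin 3 → ℤ) (D : Finset (Fin 3)) : Set E3 :=
  {x | ∀ j, (p j : ℝ) ≤ x j ∧ x j ≤ p j + if j ∈ D then 1 else 0}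

/-- A lattice point as a point of Euclidean space. -/
noncomputable def latticePoint (q : Fin 3 → ℤ) : E3 := WithLp.toLp 2 fun j => (q j : ℝ)

@[simp] lemma latticePoint_apply (q : Fin 3 → ℤ) (j : Fin 3) : latticePoint q j = q j := rfl

lemma latticePoint_injective : Function.Injective latticePoint := fun p q h => by
  funext j
  have := congrArg (fun x : E3 => x j) h
  simpa using this

lemma latticePoint_mem_cell {q p : Fin 3 → ℤ} {D : Finset (Fin 3)} :
    latticePoint q ∈ cell p D ↔ ∀ j, p j ≤ q j ∧ q j ≤ p j + if j ∈ D then 1 else 0 := by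
  refine forall_congr' fun j => ?_
  rw [latticePoint_apply, Int.cast_le]
  split_ifs
  · rw [← Int.cast_one, ← Int.cast_add, Int.cast_le]
  · rw [add_zero, add_zero, Int.cast_le]

lemma latticePoint_self_mem_cell (p : Fin 3 → ℤ) (D : Finset (Fin 3)) :
    latticePoint p ∈ cell p D := by
  rw [latticePoint_mem_cell]
  intro j
  split_ifs <;> simp

/-- The centre of a cell. -/
noncomputable def cellCenter (p : Fin 3 → ℤ) (D : Finset (Fin 3)) : E3 :=
  WithLp.toLp 2 fun j => (p j : ℝ) + if j ∈ D then 1 / 2 else 0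

@[simp] lemma cellCenter_apply (p : Fin 3 → ℤ) (D : Finset (Fin 3)) (j : Fin 3) :
    cellCenter p D j = (p j : ℝ) + if j ∈ D then 1 / 2 else 0 := rfl

lemma cellCenter_mem (p : Fin 3 → ℤ) (D : Finset (Fin 3)) : cellCenter p D ∈ cell p D := by
  intro j
  rw [cellCenter_apply]
  split_ifs <;> constructor <;> linarith

lemma unitSquare_eq_cell (p : Fin 3 → ℤ) (i : Fin 3) : unitSquare p i = cell p {i}ᶜ := by
  ext x
  simp only [unitSquare, cell, Set.mem_ofPred_eq, Finset.mem_compl, Finset.mem_singleton,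
    Set.mem_Icc]
  constructor
  · rintro ⟨h1, h2⟩ j
    by_cases hj : j = i
    · subst hj; simp [h1]
    · simpa [hj] using h2 j hj
  · intro h
    refine ⟨?_, fun j hj => by simpa [hj] using h j⟩
    have := h i
    simp only [not_true_eq_false, if_false, add_zero] at this
    exact le_antisymm this.2 this.1

lemma cell_empty (p : Fin 3 → ℤ) : cell p ∅ = {latticePoint p} := by
  ext x
  simp only [cell, Set.mem_ofPred_eq, Finset.notMem_empty, if_false, add_zero,
    Set.mem_singleton_iff]
  constructor
  · intro h
    ext j
    exact le_antisymm (h j).2 (h j).1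
  · rintro rfl j
    simp

lemma cell_subset_iff {q p : Fin 3 → ℤ} {D' D : Finset (Fin 3)} :
    cell q D' ⊆ cell p D ↔
      ∀ j, p j ≤ q j ∧ (q j + if j ∈ D' then 1 else 0) ≤ p j + if j ∈ D then 1 else 0 := by
  constructor
  · intro h j
    have h1 := latticePoint_mem_cell.1 (h (latticePoint_self_mem_cell q D')) j
    have h2 : latticePoint (fun j => q j + if j ∈ D' then 1 else 0) ∈ cell q D' := by
      rw [latticePoint_mem_cell]
      intro j
      split_ifs <;> simp
    exact ⟨h1.1, (latticePoint_mem_cell.1 (h h2) j).2⟩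
  · intro h x hx j
    obtain ⟨h1, h2⟩ := h j
    obtain ⟨h3, h4⟩ := hx j
    have h1' : (p j : ℝ) ≤ q j := by exact_mod_cast h1
    have h2' : ((q j : ℝ) + if j ∈ D' then 1 else 0) ≤ p j + if j ∈ D then 1 else 0 := by
      split_ifs at h2 ⊢ <;> exact_mod_cast h2
    exact ⟨h1'.trans h3, h4.trans h2'⟩

lemma cell_injective {q p : Fin 3 → ℤ} {D' D : Finset (Fin 3)} (h : cell q D' = cell p D) :
    q = p ∧ D' = D := by
  have h1 := cell_subset_iff.1 h.subset
  have h2 := cell_subset_iff.1 h.symm.subset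
  have hq : ∀ j, q j = p j := fun j => le_antisymm (h2 j).1 (h1 j).1
  refine ⟨funext hq, Finset.ext fun j => ?_⟩
  have h3 := (h1 j).2
  have h4 := (h2 j).2
  rw [hq j] at h3 h4
  by_cases ha : j ∈ D' <;> by_cases hb : j ∈ D <;> simp_all

/-- Two lattice cells that meet do so in a lattice cell. -/
lemma cell_inter {q p : Fin 3 → ℤ} {D' D : Finset (Fin 3)} (h : (cell q D' ∩ cell p D).Nonempty) :
    cell q D' ∩ cell p D =
      cell (fun j => max (q j) (p j)) (Finset.univ.filter fun j => j ∈ D' ∧ j ∈ D ∧ q j = p j) := by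
  obtain ⟨x, hx, hx'⟩ := h
  ext y
  simp only [Set.mem_inter_iff, cell, Set.mem_ofPred_eq, ← forall_and]
  refine forall_congr' fun j => ?_
  have h1 := hx j
  have h2 := hx' j
  have a1 : (q j : ℝ) ≤ p j + if j ∈ D then 1 else 0 := h1.1.trans h2.2
  have a2 : (p j : ℝ) ≤ q j + if j ∈ D' then 1 else 0 := h2.1.trans h1.2
  have b1 : q j ≤ p j + if j ∈ D then 1 else 0 := by
    split_ifs at a1 ⊢ <;> exact_mod_cast a1
  have b2 : p j ≤ q j + if j ∈ D' then 1 else 0 := by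
    split_ifs at a2 ⊢ <;> exact_mod_cast a2
  rcases lt_trichotomy (q j) (p j) with hlt | heq | hlt
  · have hD : j ∈ D' := by by_contra hD; simp [hD] at b2; omega
    have hq : p j = q j + 1 := by simp [hD] at b2; omega
    have : (p j : ℝ) = q j + 1 := by exact_mod_cast hq
    have hne : q j ≠ p j := hlt.ne
    have hm : max (q j) (p j) = p j := max_eq_right hlt.le
    simp only [Finset.mem_filter, hne, and_false, if_false, hm, hD, if_true]
    split_ifs <;> constructor <;> rintro ⟨_, _⟩ <;> constructor <;> (try constructor) <;> linarith
  · simp only [Finset.mem_filter, Finset.mem_univ, heq, max_self, and_true, true_and]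
    by_cases hD : j ∈ D <;> by_cases hD' : j ∈ D' <;> simp only [hD, hD', if_true, if_false,
      and_true, and_false] <;>
      constructor <;> rintro ⟨_, _⟩ <;> constructor <;> (try constructor) <;> linarith
  · have hD : j ∈ D := by by_contra hD; simp [hD] at b1; omega
    have hq : q j = p j + 1 := by simp [hD] at b1; omega
    have : (q j : ℝ) = p j + 1 := by exact_mod_cast hq
    have hne : q j ≠ p j := hlt.ne'
    have hm : max (q j) (p j) = q j := max_eq_left hlt.le
    simp only [Finset.mem_filter, hne, and_false, if_false, hm, hD, if_true]
    split_ifs <;> constructor <;> rintro ⟨_, _⟩ <;> constructor <;> (try constructor) <;> linarith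

/-! ### Convex geometry of cells: extreme points, dimension and edges -/

lemma convex_cell (p : Fin 3 → ℤ) (D : Finset (Fin 3)) : Convex ℝ (cell p D) := by
  intro x hx y hy a b ha hb hab j
  have h1 := hx j
  have h2 := hy j
  simp only [PiLp.add_apply, PiLp.smul_apply, smul_eq_mul]
  set u := (p j : ℝ) + if j ∈ D then 1 else 0
  have hb' : b = 1 - a := by linarith
  subst hb'
  constructor
  · nlinarith [mul_le_mul_of_nonneg_left h1.1 ha, mul_le_mul_of_nonneg_left h2.1 hb]
  · nlinarith [mul_le_mul_of_nonneg_left h1.2 ha, mul_le_mul_of_nonneg_left h2.2 hb]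

lemma isCompact_cell (p : Fin 3 → ℤ) (D : Finset (Fin 3)) : IsCompact (cell p D) := by
  have h : cell p D = (PiLp.homeomorph 2 (fun _ : Fin 3 => ℝ)) ⁻¹'
      (Set.univ.pi fun j => Set.Icc (p j : ℝ) (p j + if j ∈ D then 1 else 0)) := by
    ext x
    simp only [cell, Set.mem_ofPred_eq, Set.mem_preimage, Set.mem_univ_pi, Set.mem_Icc]
    rfl
  rw [h, Homeomorph.isCompact_preimage]
  exact isCompact_univ_pi fun j => isCompact_Icc

/-- Coordinatewise: where the smaller cell does not extend, its coordinate is an end of the interval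
of the larger cell, and a proper convex combination reaches an end of an interval only if both
points are there. -/
lemma isExtreme_cell {q p : Fin 3 → ℤ} {D' D : Finset (Fin 3)} (h : cell q D' ⊆ cell p D) :
    IsExtreme ℝ (cell p D) (cell q D') := by
  refine ⟨h, ?_⟩
  rintro x hx y hy z hz ⟨a, b, ha, hb, hab, rfl⟩ j
  have h1 := hx j
  have h2 := hy j
  have h3 := hz j
  obtain ⟨h4, h5⟩ := cell_subset_iff.1 h j
  simp only [PiLp.add_apply, PiLp.smul_apply, smul_eq_mul] at h3
  have hb' : b = 1 - a := by linarith
  subst hb'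
  by_cases hD' : j ∈ D'
  · have hD : j ∈ D := by
      by_contra hD
      simp only [hD, hD', if_true, if_false] at h5
      omega
    simp only [hD, hD', if_true] at h1 h2 h3 h5 ⊢
    have : q j = p j := by omega
    rw [this]
    exact h1
  · simp only [hD', if_false, add_zero] at h3 h5 ⊢
    have hz : a * x j + (1 - a) * y j = q j := le_antisymm h3.2 h3.1
    have hq : q j = p j ∨ (j ∈ D ∧ q j = p j + 1) := by
      split_ifs at h5 with hD
      · simp only [hD, true_and]; omega
      · left; omega
    have : x j = q j := by
      rcases hq with hq | ⟨hD, hq⟩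
      · rw [hq] at hz ⊢
        nlinarith
      · have hq' : (q j : ℝ) = p j + 1 := by exact_mod_cast hq
        simp only [hD, if_true] at h1 h2
        rw [hq'] at hz ⊢
        nlinarith
    rw [this]
    exact ⟨le_rfl, le_rfl⟩

/-- The extreme points of a lattice cell are the lattice points that it contains. -/
lemma mem_extremePoints_cell {p : Fin 3 → ℤ} {D : Finset (Fin 3)} {x : E3} :
    x ∈ (cell p D).extremePoints ℝ ↔ ∃ q, x = latticePoint q ∧ latticePoint q ∈ cell p D := by
  constructor
  · intro hx
    have key : ∀ j, ∃ m : ℤ, x j = m := by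
      intro j
      have hj := hx.1 j
      by_contra! hne
      have hD : j ∈ D := by
        by_contra hD
        simp only [hD, if_false, add_zero] at hj
        exact hne (p j) (le_antisymm hj.2 hj.1)
      simp only [hD, if_true] at hj
      have h0 : (p j : ℝ) < x j := lt_of_le_of_ne hj.1 (hne _).symm
      have h1 : x j < p j + 1 := lt_of_le_of_ne hj.2 (by simpa using hne (p j + 1))
      have hmem : ∀ u : ℝ, (p j : ℝ) ≤ u → u ≤ p j + 1 →
          (WithLp.toLp 2 (Function.update (fun i => x i) j u) : E3) ∈ cell p D := by
        intro u hu hu' i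
        by_cases hi : i = j
        · subst hi
          simp [hD, hu, hu']
        · simpa [hi] using hx.1 i
      -- If a coordinate of `x` is not an integer, `x` is a proper convex combination of the two
      -- points obtained by moving that coordinate to the ends of its interval.
      have := hx.2 (hmem (p j) le_rfl (by linarith)) (hmem (p j + 1) (by linarith) le_rfl)
        ⟨p j + 1 - x j, x j - p j, by linarith, by linarith, by ring, by
          ext i
          by_cases hi : i = j
          · subst hi
            simp
            ring
          · simp [hi]
            ring⟩
      have h2 := congrArg (fun y : E3 => y j) this
      simp at h2
      exact hne _ h2.symm
    choose q hq using key
    have : x = latticePoint q := by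
      ext j
      simp [hq]
    exact ⟨q, this, this ▸ hx.1⟩
  · rintro ⟨q, rfl, hq⟩
    rw [← isExtreme_singleton, ← cell_empty]
    apply isExtreme_cell
    rwa [cell_empty, Set.singleton_subset_iff]

lemma finite_extremePoints_cell (p : Fin 3 → ℤ) (D : Finset (Fin 3)) :
    ((cell p D).extremePoints ℝ).Finite := by
  refine ((Set.finite_Icc p (fun j => p j + 1)).image latticePoint).subset ?_
  intro x hx
  obtain ⟨q, rfl, hq⟩ := mem_extremePoints_cell.1 hx
  rw [latticePoint_mem_cell] at hq
  refine ⟨q, ⟨fun j => (hq j).1, fun j => ?_⟩, rfl⟩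
  have := (hq j).2
  split_ifs at this <;> simp only <;> omega

/-- Krein–Milman; the closure can be dropped because there are only finitely many extreme points. -/
lemma cell_eq_convexHull (p : Fin 3 → ℤ) (D : Finset (Fin 3)) :
    cell p D = convexHull ℝ ((cell p D).extremePoints ℝ) := by
  rw [← (finite_extremePoints_cell p D).isClosed_convexHull ℝ |>.closure_eq,
    closure_convexHull_extremePoints (isCompact_cell p D) (convex_cell p D)]

lemma vectorSpan_cell (p : Fin 3 → ℤ) (D : Finset (Fin 3)) :
    vectorSpan ℝ (cell p D) =
      Submodule.span ℝ (Set.range fun j : D => EuclideanSpace.single (j : Fin 3) (1 : ℝ)) := by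
  apply le_antisymm
  · rw [vectorSpan_def, Submodule.span_le]
    rintro _ ⟨x, hx, y, hy, rfl⟩
    have hxy : x - y = ∑ j : Fin 3, (x j - y j) • EuclideanSpace.single j (1 : ℝ) := by
      ext i
      fin_cases i <;> simp [Fin.sum_univ_three]
    simp only [vsub_eq_sub]
    rw [hxy]
    refine Submodule.sum_mem _ fun j _ => ?_
    by_cases hD : j ∈ D
    · exact Submodule.smul_mem _ _ (Submodule.subset_span ⟨⟨j, hD⟩, rfl⟩)
    · have h1 := hx j
      have h2 := hy j
      simp only [hD, if_false, add_zero] at h1 h2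
      have : x j - y j = 0 := by linarith [h1.1, h1.2, h2.1, h2.2]
      rw [this, zero_smul]
      exact Submodule.zero_mem _
  · rw [Submodule.span_le]
    rintro _ ⟨⟨j, hj⟩, rfl⟩
    have h1 : latticePoint (Function.update p j (p j + 1)) ∈ cell p D := by
      rw [latticePoint_mem_cell]
      intro i
      by_cases hi : i = j
      · subst hi; simp [hj]
      · simp only [Function.update_of_ne hi]
        split_ifs <;> simp
    have := vsub_mem_vectorSpan ℝ h1 (latticePoint_self_mem_cell p D)
    have h2 : EuclideanSpace.single j (1 : ℝ) =
        latticePoint (Function.update p j (p j + 1)) -ᵥ latticePoint p := by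
      ext i
      by_cases hi : i = j
      · subst hi; simp
      · simp [hi]
    simpa only [h2, SetLike.mem_coe] using this

lemma finrank_vectorSpan_cell (p : Fin 3 → ℤ) (D : Finset (Fin 3)) :
    Module.finrank ℝ (vectorSpan ℝ (cell p D)) = D.card := by
  have h := (EuclideanSpace.basisFun (Fin 3) ℝ).toBasis.linearIndependent.comp
    (fun j : D => (j : Fin 3)) Subtype.val_injective
  have h2 : (EuclideanSpace.basisFun (Fin 3) ℝ).toBasis ∘ (fun j : D => (j : Fin 3)) =
      fun j : D => EuclideanSpace.single (j : Fin 3) (1 : ℝ) := by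
    funext j
    simp
  rw [h2] at h
  rw [vectorSpan_cell]
  exact (finrank_span_eq_card h).trans (Fintype.card_coe D)

lemma isConvexPolygon_unitSquare (p : Fin 3 → ℤ) (i : Fin 3) :
    IsConvexPolygon (unitSquare p i) := by
  rw [unitSquare_eq_cell]
  refine ⟨⟨_, finite_extremePoints_cell p _, cell_eq_convexHull p _⟩, ?_⟩
  rw [finrank_vectorSpan_cell, Finset.card_compl]
  simp

lemma mem_polygonVertices_unitSquare {p : Fin 3 → ℤ} {i : Fin 3} {x : E3} :
    x ∈ polygonVertices (unitSquare p i) ↔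
      ∃ q, x = latticePoint q ∧ latticePoint q ∈ unitSquare p i := by
  rw [unitSquare_eq_cell]
  exact mem_extremePoints_cell

lemma cell_singleton_eq_segment (q : Fin 3 → ℤ) (j : Fin 3) :
    cell q {j} = segment ℝ (latticePoint q) (latticePoint (Function.update q j (q j + 1))) := by
  apply Set.Subset.antisymm
  · intro x hx
    have hj := hx j
    simp only [Finset.mem_singleton, if_true] at hj
    refine ⟨q j + 1 - x j, x j - q j, by linarith, by linarith, by ring, ?_⟩
    ext i
    by_cases hi : i = j
    · subst hi; simp; ring
    · have := hx i
      simp only [Finset.mem_singleton, hi, if_false, add_zero] at this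
      simp [hi]
      rw [← le_antisymm this.2 this.1]
      ring
  · refine (convex_cell q {j}).segment_subset (latticePoint_self_mem_cell _ _) ?_
    rw [latticePoint_mem_cell]
    intro i
    by_cases hi : i = j
    · subst hi; simp
    · simp [hi]

lemma left_mem_extremePoints_segment (a b : E3) : a ∈ (segment ℝ a b).extremePoints ℝ := by
  by_cases hab : a = b
  · subst hab; simp
  refine ⟨left_mem_segment ℝ a b, ?_⟩
  intro x hx y hy hxy
  rw [segment_eq_image'] at hx hy
  obtain ⟨s, ⟨hs, -⟩, rfl⟩ := hx
  obtain ⟨t, ⟨ht, -⟩, rfl⟩ := hy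
  obtain ⟨u, v, hu, hv, huv, h⟩ := hxy
  have h1 : (u * s + v * t) • (b - a) = 0 := by
    have h2 : u • (a + s • (b - a)) + v • (a + t • (b - a)) =
        (u + v) • a + (u * s + v * t) • (b - a) := by module
    rw [h2, huv, one_smul] at h
    simpa using h
  have h3 : u * s + v * t = 0 := by
    rcases smul_eq_zero.1 h1 with h | h
    · exact h
    · exact absurd (sub_eq_zero.1 h).symm hab
  have : s = 0 := by
    have := mul_nonneg hv.le ht
    nlinarith [mul_nonneg hu.le hs]
  simp [this]

/-- The edges of a unit square are the lattice edges that it contains. -/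
lemma mem_polygonEdges_unitSquare {p : Fin 3 → ℤ} {i : Fin 3} {e : Set E3} :
    e ∈ polygonEdges (unitSquare p i) ↔ ∃ q j, e = cell q {j} ∧ cell q {j} ⊆ unitSquare p i := by
  constructor
  · rintro ⟨a, b, hab, rfl, he⟩
    have ha := he.extremePoints_subset_extremePoints (left_mem_extremePoints_segment a b)
    have hb := he.extremePoints_subset_extremePoints
      (segment_symm ℝ b a ▸ left_mem_extremePoints_segment b a)
    obtain ⟨q, rfl, hq⟩ := mem_polygonVertices_unitSquare.1 ha
    obtain ⟨r, rfl, hr⟩ := mem_polygonVertices_unitSquare.1 hb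
    have hqr : q ≠ r := fun h => hab (by rw [h])
    obtain ⟨j, hj⟩ := Function.ne_iff.1 hqr
    -- An edge cannot be a diagonal: exchanging the `j`-coordinates of the two ends gives two
    -- further corners of the square with the same midpoint. Extremality would put such a corner on
    -- the segment, which forces the ends to agree in coordinate `j`.
    have hother : ∀ l, l ≠ j → q l = r l := by
      intro l hl
      by_contra hne
      have hmem : ∀ (s t : Fin 3 → ℤ), latticePoint s ∈ unitSquare p i →
          latticePoint t ∈ unitSquare p i →
          latticePoint (Function.update s j (t j)) ∈ unitSquare p i := by
        intro s t hs ht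
        rw [unitSquare_eq_cell, latticePoint_mem_cell] at hs ht ⊢
        intro m
        by_cases hm : m = j
        · subst hm; simpa using ht m
        · simpa [hm] using hs m
      have hu := he.2 (hmem q r hq hr) (hmem r q hr hq)
        (z := (1 / 2 : ℝ) • latticePoint q + (1 / 2 : ℝ) • latticePoint r)
        ⟨1 / 2, 1 / 2, by norm_num, by norm_num, by norm_num, rfl⟩
        ⟨1 / 2, 1 / 2, by norm_num, by norm_num, by norm_num, by
          ext m
          by_cases hm : m = j
          · subst hm; simp; ring
          · simp [hm]⟩
      rw [segment_eq_image'] at hu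
      obtain ⟨s, -, hs⟩ := hu
      have h1 := congrArg (fun x : E3 => x l) hs
      have h2 := congrArg (fun x : E3 => x j) hs
      simp [hl] at h1 h2
      have hne' : (r l : ℝ) - q l ≠ 0 := by
        intro h
        apply hne
        have : (q l : ℝ) = r l := by linarith
        exact_mod_cast this
      have hs0 : s = 0 := by
        rcases h1 with h | h
        · exact h
        · exact absurd h hne'
      rw [hs0] at h2
      apply hj
      have : (q j : ℝ) = r j := by linarith
      exact_mod_cast this
    have main : ∀ s t : Fin 3 → ℤ, latticePoint s ∈ unitSquare p i →
        latticePoint t ∈ unitSquare p i → s j < t j → (∀ l, l ≠ j → s l = t l) →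
        segment ℝ (latticePoint s) (latticePoint t) = cell s {j} := by
      intro s t hs ht hlt hst
      rw [cell_singleton_eq_segment]
      congr 2
      funext l
      by_cases hl : l = j
      · subst hl
        rw [unitSquare_eq_cell, latticePoint_mem_cell] at hs ht
        have h1 := hs l
        have h2 := ht l
        split_ifs at h1 h2 <;> simp <;> omega
      · simp [hl, hst l hl]
    rcases lt_or_gt_of_ne hj with hlt | hlt
    · have := main q r hq hr hlt hother
      exact ⟨q, j, this, this ▸ he.1⟩
    · have := main r q hr hq hlt fun l hl => (hother l hl).symm
      rw [segment_symm] at this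
      exact ⟨r, j, this, this ▸ he.1⟩
  · rintro ⟨q, j, rfl, h⟩
    refine ⟨_, _, ?_, cell_singleton_eq_segment q j, ?_⟩
    · intro h
      have := congrFun (latticePoint_injective h) j
      simp at this
    · rw [unitSquare_eq_cell] at h ⊢
      exact isExtreme_cell h

/-! ### Unions of lattice cubes and their boundaries -/

/-- The union of the lattice cubes with lowest corners in `S`. -/
def solidOf (S : Set (Fin 3 → ℤ)) : Set E3 := ⋃ p ∈ S, cell p Finset.univ

lemma mem_solidOf {S : Set (Fin 3 → ℤ)} {x : E3} :
    x ∈ solidOf S ↔ ∃ p ∈ S, x ∈ cell p Finset.univ := by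
  simp [solidOf]

lemma exists_mem_cube (x : E3) : ∃ p, x ∈ cell p Finset.univ :=
  ⟨fun j => ⌊x j⌋, fun j => ⟨Int.floor_le _, by simpa using (Int.lt_floor_add_one _).le⟩⟩

lemma continuous_coord (j : Fin 3) : Continuous fun x : E3 => x j :=
  (EuclideanSpace.proj (𝕜 := ℝ) j).continuous

/-- The lattice cubes that come close to `x` contain `x`. -/
lemma exists_isOpen_cube (x : E3) : ∃ U : Set E3, IsOpen U ∧ x ∈ U ∧
    ∀ y ∈ U, ∀ q, y ∈ cell q Finset.univ → x ∈ cell q Finset.univ := by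
  refine ⟨⋂ j, {y | (⌈x j⌉ : ℝ) - 1 < y j ∧ y j < ⌊x j⌋ + 1}, ?_, ?_, ?_⟩
  · refine isOpen_iInter_of_finite fun j => ?_
    exact (isOpen_lt continuous_const (continuous_coord j)).inter
      (isOpen_lt (continuous_coord j) continuous_const)
  · simp only [Set.mem_iInter, Set.mem_ofPred_eq]
    exact fun j => ⟨by linarith [Int.ceil_lt_add_one (x j)], Int.lt_floor_add_one _⟩
  · intro y hy q hq j
    simp only [Set.mem_iInter, Set.mem_ofPred_eq] at hy
    obtain ⟨h1, h2⟩ := hy j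
    have hqj := hq j
    simp only [Finset.mem_univ, if_true] at hqj ⊢
    have h3 : (q j : ℝ) < ⌊x j⌋ + 1 := hqj.1.trans_lt h2
    have h4 : (⌈x j⌉ : ℝ) < q j + 1 + 1 := by linarith
    have h5 : q j ≤ ⌊x j⌋ := Int.lt_add_one_iff.1 (by exact_mod_cast h3)
    have h6 : ⌈x j⌉ ≤ q j + 1 := Int.lt_add_one_iff.1 (by exact_mod_cast h4)
    refine ⟨Int.le_floor.1 h5, ?_⟩
    have := Int.ceil_le.1 h6
    simpa using this

lemma isClosed_solidOf (S : Set (Fin 3 → ℤ)) : IsClosed (solidOf S) := by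
  rw [← isOpen_compl_iff, isOpen_iff_forall_mem_open]
  intro x hx
  obtain ⟨U, hU, hxU, h⟩ := exists_isOpen_cube x
  refine ⟨U, fun y hy hyS => hx ?_, hU, hxU⟩
  obtain ⟨p, hp, hyp⟩ := mem_solidOf.1 hyS
  exact mem_solidOf.2 ⟨p, hp, h y hy p hyp⟩

/-- If a cube `q` contains `x`, the points on the way from `x` to the centre of `q` are strictly
inside `q` and thus in no other cube; those close to `x` are in the solid, so `q` belongs to `S`.
Conversely, near `x` only cubes containing `x` occur. -/
lemma mem_interior_solidOf {S : Set (Fin 3 → ℤ)} {x : E3} :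
    x ∈ interior (solidOf S) ↔ ∀ q, x ∈ cell q Finset.univ → q ∈ S := by
  constructor
  · intro hx q hq
    let γ : ℝ → E3 := fun t => x + t • (cellCenter q Finset.univ - x)
    have hγ : Continuous γ := by fun_prop
    have h1 : ∀ᶠ t in nhds (0 : ℝ), γ t ∈ interior (solidOf S) := by
      refine hγ.continuousAt.eventually_mem (isOpen_interior.mem_nhds ?_)
      simpa [γ] using hx
    have h2 : ∀ᶠ t in nhdsWithin (0 : ℝ) (Set.Ioi 0), t ∈ Set.Ioo (0 : ℝ) 1 :=
      Ioo_mem_nhdsGT one_pos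
    obtain ⟨t, ht, ht0, ht1⟩ := ((h1.filter_mono nhdsWithin_le_nhds).and h2).exists
    obtain ⟨a, ha, hta⟩ := mem_solidOf.1 (interior_subset ht)
    have : q = a := by
      funext j
      have h3 := hta j
      have h4 := hq j
      simp only [γ, Finset.mem_univ, if_true, PiLp.add_apply, PiLp.smul_apply, PiLp.sub_apply,
        cellCenter_apply, smul_eq_mul] at h3 h4
      have h5 : (q j : ℝ) < a j + 1 := by nlinarith
      have h6 : (a j : ℝ) < q j + 1 := by nlinarith
      have h7 : q j < a j + 1 := by exact_mod_cast h5
      have h8 : a j < q j + 1 := by exact_mod_cast h6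
      omega
    exact this ▸ ha
  · intro h
    obtain ⟨U, hU, hxU, hU'⟩ := exists_isOpen_cube x
    refine mem_interior.2 ⟨U, fun y hy => ?_, hU, hxU⟩
    obtain ⟨p, hp⟩ := exists_mem_cube y
    exact mem_solidOf.2 ⟨p, h p (hU' y hy p hp), hp⟩

lemma mem_frontier_solidOf {S : Set (Fin 3 → ℤ)} {x : E3} :
    x ∈ frontier (solidOf S) ↔
      (∃ a ∈ S, x ∈ cell a Finset.univ) ∧ ∃ b ∉ S, x ∈ cell b Finset.univ := by
  rw [(isClosed_solidOf S).frontier_eq, Set.mem_sdiff, mem_solidOf, mem_interior_solidOf]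
  refine and_congr_right fun _ => ?_
  push Not
  exact exists_congr fun q => and_comm

/-- A cell is mixed if it lies both in a cube of `S` and in a cube outside `S`. -/
def Mixed (S : Set (Fin 3 → ℤ)) (p : Fin 3 → ℤ) (D : Finset (Fin 3)) : Prop :=
  (∃ a ∈ S, cell p D ⊆ cell a Finset.univ) ∧ ∃ b ∉ S, cell p D ⊆ cell b Finset.univ

lemma cell_subset_cube_iff {p a : Fin 3 → ℤ} {D : Finset (Fin 3)} :
    cell p D ⊆ cell a Finset.univ ↔ ∀ j, p j = a j ∨ (j ∉ D ∧ p j = a j + 1) := by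
  rw [cell_subset_iff]
  refine forall_congr' fun j => ?_
  by_cases h : j ∈ D <;> simp [h] <;> omega

/-- One point decides: each coordinate of the centre is an integer or a half-integer, so a cube that
contains the centre contains the cell. This turns inclusion of a cell in the boundary into the
combinatorial condition `Mixed`. -/
lemma cell_subset_cube_of_center_mem {p a : Fin 3 → ℤ} {D : Finset (Fin 3)}
    (h : cellCenter p D ∈ cell a Finset.univ) : cell p D ⊆ cell a Finset.univ := by
  rw [cell_subset_cube_iff]
  intro j
  have h1 := h j
  simp only [cellCenter_apply, Finset.mem_univ, if_true] at h1
  by_cases hj : j ∈ D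
  · simp only [hj, if_true] at h1
    have h2 : (a j : ℝ) < p j + 1 := by linarith
    have h3 : (p j : ℝ) < a j + 1 := by linarith
    have h4 : a j < p j + 1 := by exact_mod_cast h2
    have h5 : p j < a j + 1 := by exact_mod_cast h3
    left; omega
  · simp only [hj, if_false, add_zero] at h1
    have h4 : a j ≤ p j := by exact_mod_cast h1.1
    have h5 : p j ≤ a j + 1 := by exact_mod_cast h1.2
    simp only [hj, not_false_eq_true, true_and]
    omega

lemma cell_subset_frontier_iff {S : Set (Fin 3 → ℤ)} {p : Fin 3 → ℤ} {D : Finset (Fin 3)} :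
    cell p D ⊆ frontier (solidOf S) ↔ Mixed S p D := by
  constructor
  · intro h
    obtain ⟨⟨a, ha, hpa⟩, b, hb, hpb⟩ := mem_frontier_solidOf.1 (h (cellCenter_mem p D))
    exact ⟨⟨a, ha, cell_subset_cube_of_center_mem hpa⟩, b, hb, cell_subset_cube_of_center_mem hpb⟩
  · rintro ⟨⟨a, ha, hpa⟩, b, hb, hpb⟩ x hx
    exact mem_frontier_solidOf.2 ⟨⟨a, ha, hpa hx⟩, b, hb, hpb hx⟩

/-- A square lies in just two cubes, one on each side, so it is mixed when exactly one of them
belongs to `S`. -/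
lemma mixed_compl_singleton_iff {S : Set (Fin 3 → ℤ)} {p : Fin 3 → ℤ} {i : Fin 3} :
    Mixed S p {i}ᶜ ↔ ¬(p ∈ S ↔ Function.update p i (p i - 1) ∈ S) := by
  have key : ∀ a, cell p {i}ᶜ ⊆ cell a Finset.univ ↔ a = p ∨ a = Function.update p i (p i - 1) := by
    intro a
    rw [cell_subset_cube_iff]
    constructor
    · intro h
      rcases h i with hi | ⟨-, hi⟩
      · left
        funext j
        have := h j
        by_cases hj : j = i
        · rw [hj, hi]
        · simp [hj] at this; exact this.symm
      · right
        funext j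
        have := h j
        by_cases hj : j = i
        · subst hj; simp; omega
        · simp [hj] at this; simp [hj, this]
    · rintro (rfl | rfl) j
      · exact Or.inl rfl
      · by_cases hj : j = i
        · subst hj; right; simp
        · left; simp [hj]
  unfold Mixed
  simp only [key]
  constructor
  · rintro ⟨⟨a, ha, rfl | rfl⟩, b, hb, rfl | rfl⟩ h <;> tauto
  · intro h
    by_cases hp : p ∈ S
    · exact ⟨⟨p, hp, Or.inl rfl⟩, _, fun h' => h ⟨fun _ => h', fun _ => hp⟩, Or.inr rfl⟩
    · refine ⟨⟨_, ?_, Or.inr rfl⟩, p, hp, Or.inl rfl⟩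
      by_contra h'
      exact h ⟨fun h => absurd h hp, fun h => absurd h h'⟩

/-- Two distinct cubes that differ in one coordinate and share a point are neighbours, and their
intersection is the square between them. -/
lemma exists_mixed_square_of_update {S : Set (Fin 3 → ℤ)} {T : Set E3} (hT : T.Nonempty)
    {a : Fin 3 → ℤ} {i : Fin 3} {m : ℤ} (hab : ¬(a ∈ S ↔ Function.update a i m ∈ S))
    (ha : T ⊆ cell a Finset.univ) (hb : T ⊆ cell (Function.update a i m) Finset.univ) :
    ∃ p i, Mixed S p {i}ᶜ ∧ T ⊆ cell p {i}ᶜ := by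
  have hne : a i ≠ m := by
    rintro rfl
    simp at hab
  have hai : ∀ x ∈ T, (a i : ℝ) ≤ x i ∧ x i ≤ a i + 1 := fun x hx => by simpa using ha hx i
  have hbi : ∀ x ∈ T, (m : ℝ) ≤ x i ∧ x i ≤ m + 1 := fun x hx => by simpa using hb hx i
  have hT' : ∀ p : Fin 3 → ℤ, (∀ j, j ≠ i → p j = a j) → (∀ x ∈ T, x i = p i) →
      T ⊆ cell p {i}ᶜ := by
    intro p hp hpi x hx j
    by_cases hj : j = i
    · subst hj
      simp [hpi x hx]
    · simpa [hj, hp j hj] using ha hx j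
  obtain ⟨x₀, hx₀⟩ := hT
  have h1' : (m : ℝ) ≤ a i + 1 := (hbi x₀ hx₀).1.trans (hai x₀ hx₀).2
  have h2' : (a i : ℝ) ≤ m + 1 := (hai x₀ hx₀).1.trans (hbi x₀ hx₀).2
  have h1 : m ≤ a i + 1 := by exact_mod_cast h1'
  have h2 : a i ≤ m + 1 := by exact_mod_cast h2'
  rcases lt_or_gt_of_ne hne with hlt | hlt
  · have hm : m = a i + 1 := by omega
    subst hm
    refine ⟨Function.update a i (a i + 1), i, ?_, hT' _ (fun j hj => by simp [hj]) fun x hx => ?_⟩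
    · rw [mixed_compl_singleton_iff]
      simp only [Function.update_self, add_sub_cancel_right, Function.update_idem,
        Function.update_eq_self]
      tauto
    · have := hai x hx
      have := hbi x hx
      push_cast at this
      simp
      linarith
  · have hm : m = a i - 1 := by omega
    subst hm
    refine ⟨a, i, ?_, hT' _ (fun j hj => rfl) fun x hx => ?_⟩
    · rwa [mixed_compl_singleton_iff]
    · have := hai x hx
      have := hbi x hx
      push_cast at this
      linarith

/-- A set that lies in a cube of `S` and in a cube outside `S` lies in a mixed square. -/
lemma exists_mixed_square {S : Set (Fin 3 → ℤ)} {T : Set E3} (hT : T.Nonempty)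
    {a b : Fin 3 → ℤ} (ha : a ∈ S) (hb : b ∉ S)
    (hTa : T ⊆ cell a Finset.univ) (hTb : T ⊆ cell b Finset.univ) :
    ∃ p i, Mixed S p {i}ᶜ ∧ T ⊆ cell p {i}ᶜ := by
  have hupd : ∀ c : Fin 3 → ℤ, T ⊆ cell c Finset.univ → ∀ i,
      T ⊆ cell (Function.update c i (b i)) Finset.univ := by
    intro c hc i x hx j
    by_cases hj : j = i
    · subst hj
      simpa using hTb hx j
    · simpa [hj] using hc hx j
  -- The coordinates of `a` are changed to those of `b` one at a time. All cubes on the way contain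
  -- `T`, and membership in `S` is lost at some step.
  set a₁ := Function.update a 0 (b 0) with ha₁
  set a₂ := Function.update a₁ 1 (b 1) with ha₂
  have hb' : Function.update a₂ 2 (b 2) = b := by
    funext j
    fin_cases j <;> simp [ha₁, ha₂]
  have h₁ : T ⊆ cell a₁ Finset.univ := hupd a hTa 0
  have h₂ : T ⊆ cell a₂ Finset.univ := hupd a₁ h₁ 1
  by_cases h1 : a₁ ∈ S
  · by_cases h2 : a₂ ∈ S
    · refine exists_mixed_square_of_update hT (a := a₂) (i := 2) (m := b 2) ?_ h₂ (hupd _ h₂ 2)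
      rw [hb']
      tauto
    · exact exists_mixed_square_of_update hT (a := a₁) (i := 1) (m := b 1) (by tauto) h₁ h₂
  · exact exists_mixed_square_of_update hT (a := a) (i := 0) (m := b 0) (by tauto) hTa h₁

/-- The unit lattice squares in the boundary of a union of lattice cubes. -/
def surfaceOf (S : Set (Fin 3 → ℤ)) : Set (Set E3) :=
  {f | (∃ p i, f = unitSquare p i) ∧ f ⊆ frontier (solidOf S)}

lemma mem_surfaceOf {S : Set (Fin 3 → ℤ)} {f : Set E3} :
    f ∈ surfaceOf S ↔ ∃ p i, f = cell p {i}ᶜ ∧ Mixed S p {i}ᶜ := by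
  constructor
  · rintro ⟨⟨p, i, rfl⟩, h⟩
    rw [unitSquare_eq_cell] at h
    exact ⟨p, i, unitSquare_eq_cell p i, cell_subset_frontier_iff.1 h⟩
  · rintro ⟨p, i, rfl, h⟩
    exact ⟨⟨p, i, (unitSquare_eq_cell p i).symm⟩, cell_subset_frontier_iff.2 h⟩

lemma Mixed.exists_square {S : Set (Fin 3 → ℤ)} {q : Fin 3 → ℤ} {D : Finset (Fin 3)}
    (h : Mixed S q D) : ∃ p i, Mixed S p {i}ᶜ ∧ cell q D ⊆ cell p {i}ᶜ := by
  obtain ⟨⟨a, ha, hqa⟩, b, hb, hqb⟩ := h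
  exact exists_mixed_square ⟨_, cellCenter_mem q D⟩ ha hb hqa hqb

lemma Mixed.of_subset {S : Set (Fin 3 → ℤ)} {q p : Fin 3 → ℤ} {D' D : Finset (Fin 3)}
    (h : Mixed S p D) (hqp : cell q D' ⊆ cell p D) : Mixed S q D' :=
  cell_subset_frontier_iff.1 (hqp.trans (cell_subset_frontier_iff.2 h))

lemma sUnion_surfaceOf (S : Set (Fin 3 → ℤ)) : ⋃₀ surfaceOf S = frontier (solidOf S) := by
  apply Set.Subset.antisymm
  · exact Set.sUnion_subset fun f hf => hf.2
  · intro x hx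
    obtain ⟨⟨a, ha, hxa⟩, b, hb, hxb⟩ := mem_frontier_solidOf.1 hx
    obtain ⟨p, i, hp, hxp⟩ := exists_mixed_square (Set.singleton_nonempty x) ha hb
      (Set.singleton_subset_iff.2 hxa) (Set.singleton_subset_iff.2 hxb)
    exact ⟨_, mem_surfaceOf.2 ⟨p, i, rfl, hp⟩, Set.singleton_subset_iff.1 hxp⟩

/-! ### Vertices, edges and faces of the surface as mixed cells -/

lemma mem_vertices_surfaceOf {S : Set (Fin 3 → ℤ)} {v : E3} :
    v ∈ vertices (surfaceOf S) ↔ ∃ q, v = latticePoint q ∧ Mixed S q ∅ := by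
  constructor
  · rintro ⟨f, hf, hv⟩
    obtain ⟨p, i, rfl, hp⟩ := mem_surfaceOf.1 hf
    obtain ⟨q, rfl, hq⟩ := mem_extremePoints_cell.1 hv
    exact ⟨q, rfl, hp.of_subset (by rwa [cell_empty, Set.singleton_subset_iff])⟩
  · rintro ⟨q, rfl, hq⟩
    obtain ⟨p, i, hp, hqp⟩ := hq.exists_square
    rw [cell_empty, Set.singleton_subset_iff] at hqp
    exact ⟨_, mem_surfaceOf.2 ⟨p, i, rfl, hp⟩, mem_extremePoints_cell.2 ⟨q, rfl, hqp⟩⟩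

lemma mem_polygonEdges_cell {p : Fin 3 → ℤ} {i : Fin 3} {e : Set E3} :
    e ∈ polygonEdges (cell p {i}ᶜ) ↔ ∃ q j, e = cell q {j} ∧ cell q {j} ⊆ cell p {i}ᶜ := by
  rw [← unitSquare_eq_cell]
  exact mem_polygonEdges_unitSquare

lemma mem_edges_surfaceOf {S : Set (Fin 3 → ℤ)} {e : Set E3} :
    e ∈ edges (surfaceOf S) ↔ ∃ q j, e = cell q {j} ∧ Mixed S q {j} := by
  constructor
  · rintro ⟨f, hf, he⟩
    obtain ⟨p, i, rfl, hp⟩ := mem_surfaceOf.1 hf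
    obtain ⟨q, j, rfl, hq⟩ := mem_polygonEdges_cell.1 he
    exact ⟨q, j, rfl, hp.of_subset hq⟩
  · rintro ⟨q, j, rfl, hq⟩
    obtain ⟨p, i, hp, hqp⟩ := hq.exists_square
    exact ⟨_, mem_surfaceOf.2 ⟨p, i, rfl, hp⟩, mem_polygonEdges_cell.2 ⟨q, j, rfl, hqp⟩⟩

lemma finite_mixed {S : Set (Fin 3 → ℤ)} (hS : S.Finite) (D : Finset (Fin 3)) :
    {p | Mixed S p D}.Finite := by
  refine (hS.biUnion fun a _ => Set.finite_Icc a (fun j => a j + 1)).subset ?_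
  rintro p ⟨⟨a, ha, hpa⟩, -⟩
  refine Set.mem_iUnion₂.2 ⟨a, ha, fun j => ?_, fun j => ?_⟩
  · rcases cell_subset_cube_iff.1 hpa j with h | ⟨-, h⟩ <;> show a j ≤ p j <;> omega
  · rcases cell_subset_cube_iff.1 hpa j with h | ⟨-, h⟩ <;> show p j ≤ a j + 1 <;> omega

lemma surfaceOf_eq_image (S : Set (Fin 3 → ℤ)) : surfaceOf S =
    (fun x : (_ : Fin 3) × (Fin 3 → ℤ) => cell x.2 {x.1}ᶜ) '' {x | Mixed S x.2 {x.1}ᶜ} := by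
  ext f
  rw [mem_surfaceOf]
  constructor
  · rintro ⟨p, i, rfl, h⟩
    exact ⟨⟨i, p⟩, h, rfl⟩
  · rintro ⟨⟨i, p⟩, h, rfl⟩
    exact ⟨p, i, rfl, h⟩

lemma edges_surfaceOf_eq_image (S : Set (Fin 3 → ℤ)) : edges (surfaceOf S) =
    (fun x : (_ : Fin 3) × (Fin 3 → ℤ) => cell x.2 {x.1}) '' {x | Mixed S x.2 {x.1}} := by
  ext f
  rw [mem_edges_surfaceOf]
  constructor
  · rintro ⟨p, i, rfl, h⟩
    exact ⟨⟨i, p⟩, h, rfl⟩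
  · rintro ⟨⟨i, p⟩, h, rfl⟩
    exact ⟨p, i, rfl, h⟩

lemma vertices_surfaceOf_eq_image (S : Set (Fin 3 → ℤ)) :
    vertices (surfaceOf S) = latticePoint '' {q | Mixed S q ∅} := by
  ext f
  rw [mem_vertices_surfaceOf]
  constructor
  · rintro ⟨p, rfl, h⟩
    exact ⟨p, h, rfl⟩
  · rintro ⟨p, h, rfl⟩
    exact ⟨p, rfl, h⟩

lemma ncard_sigma_eq_sum {P : Fin 3 → (Fin 3 → ℤ) → Prop} (h : ∀ i, {p | P i p}.Finite) :
    {x : (_ : Fin 3) × (Fin 3 → ℤ) | P x.1 x.2}.ncard = ∑ i, {p | P i p}.ncard := by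
  have : ∀ i, Finite {p | P i p} := h
  have e : {x : (_ : Fin 3) × (Fin 3 → ℤ) | P x.1 x.2} ≃ (i : Fin 3) × {p | P i p} :=
    { toFun := fun x => ⟨x.1.1, x.1.2, x.2⟩
      invFun := fun x => ⟨⟨x.1, x.2.1⟩, x.2.2⟩
      left_inv := fun _ => rfl
      right_inv := fun _ => rfl }
  rw [← Nat.card_coe_set_eq, Nat.card_congr e, Nat.card_sigma]
  rfl

lemma eulerChar_surfaceOf {S : Set (Fin 3 → ℤ)} (hS : S.Finite) :
    eulerChar (surfaceOf S) = ({p | Mixed S p ∅}.ncard : ℤ)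
      - ∑ i, ({p | Mixed S p {i}}.ncard : ℤ) + ∑ i, ({p | Mixed S p {i}ᶜ}.ncard : ℤ) := by
  unfold eulerChar
  rw [vertices_surfaceOf_eq_image, Set.ncard_image_of_injective _ latticePoint_injective,
    edges_surfaceOf_eq_image, Set.ncard_image_of_injective, surfaceOf_eq_image,
    Set.ncard_image_of_injective, ncard_sigma_eq_sum (P := fun i p => Mixed S p {i}),
    ncard_sigma_eq_sum (P := fun i p => Mixed S p {i}ᶜ)]
  · push_cast
    rfl
  · exact fun i => finite_mixed hS _
  · exact fun i => finite_mixed hS _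
  · rintro ⟨i, p⟩ ⟨j, q⟩ h
    obtain ⟨h1, h2⟩ := cell_injective h
    simp only at h1 h2
    rw [compl_inj_iff, Finset.singleton_inj] at h2
    rw [h1, h2]
  · rintro ⟨i, p⟩ ⟨j, q⟩ h
    obtain ⟨h1, h2⟩ := cell_injective h
    simp only at h1 h2
    rw [Finset.singleton_inj] at h2
    rw [h1, h2]

lemma finset_fin_three_cases : ∀ (D : Finset (Fin 3)) (i : Fin 3), D ⊆ {i}ᶜ →
    D = ∅ ∨ (∃ j, D = {j}) ∨ D = {i}ᶜ := by
  decide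

lemma eq_of_cell_subset {q p : Fin 3 → ℤ} {D : Finset (Fin 3)} (h : cell q D ⊆ cell p D) :
    q = p := by
  funext j
  have := cell_subset_iff.1 h j
  split_ifs at this <;> omega

lemma isPolyhedron_surfaceOf {S : Set (Fin 3 → ℤ)} (hS : S.Finite) :
    IsPolyhedron (surfaceOf S) where
  finite := by
    refine (Set.finite_iUnion fun i => (finite_mixed hS {i}ᶜ).image fun p => cell p {i}ᶜ).subset ?_
    intro f hf
    obtain ⟨p, i, rfl, hp⟩ := mem_surfaceOf.1 hf
    exact Set.mem_iUnion.2 ⟨i, p, hp, rfl⟩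
  polygon := by
    rintro f ⟨⟨p, i, rfl⟩, -⟩
    exact isConvexPolygon_unitSquare p i
  glue := by
    intro f hf g hg hfg
    obtain ⟨p, i, rfl, hp⟩ := mem_surfaceOf.1 hf
    obtain ⟨q, l, rfl, hq⟩ := mem_surfaceOf.1 hg
    by_cases hne : (cell p {i}ᶜ ∩ cell q {l}ᶜ).Nonempty
    · right
      obtain ⟨r, D, hr, hi, hl⟩ : ∃ r D, cell p {i}ᶜ ∩ cell q {l}ᶜ = cell r D ∧
          D ⊆ {i}ᶜ ∧ D ⊆ {l}ᶜ :=
        ⟨_, _, cell_inter hne, fun j hj => (Finset.mem_filter.1 hj).2.1,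
          fun j hj => (Finset.mem_filter.1 hj).2.2.1⟩
      have h1 : cell r D ⊆ cell p {i}ᶜ := hr ▸ Set.inter_subset_left
      have h2 : cell r D ⊆ cell q {l}ᶜ := hr ▸ Set.inter_subset_right
      rw [hr]
      rcases finset_fin_three_cases D i hi with rfl | ⟨j, rfl⟩ | rfl
      · left
        rw [cell_empty] at h1 h2 ⊢
        rw [Set.singleton_subset_iff] at h1 h2
        exact ⟨_, mem_extremePoints_cell.2 ⟨r, rfl, h1⟩, mem_extremePoints_cell.2 ⟨r, rfl, h2⟩, rfl⟩
      · right
        exact ⟨mem_polygonEdges_cell.2 ⟨r, j, rfl, h1⟩, mem_polygonEdges_cell.2 ⟨r, j, rfl, h2⟩⟩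
      -- Both squares have the two-dimensional intersection as a subset, so they share its
      -- directions and its lowest corner and coincide.
      · exfalso
        have hil : l = i := by simpa using hl
        subst hil
        exact hfg (by rw [← eq_of_cell_subset h1, ← eq_of_cell_subset h2])
    · left
      exact Set.not_nonempty_iff_eq_empty.1 hne

/-! ### Unions of cubes that are bounded by closed surfaces -/

/-- No two cubes of `S` that share only an edge are separated along that edge by two cubes outside
`S`. -/
def NoDiagonal (S : Set (Fin 3 → ℤ)) : Prop :=
  ∀ (q : Fin 3 → ℤ) (i l : Fin 3), i ≠ l →
    (q ∈ S ↔ Function.update (Function.update q i (q i - 1)) l (q l - 1) ∈ S) →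
    (Function.update q i (q i - 1) ∈ S ↔ Function.update q l (q l - 1) ∈ S) →
    (q ∈ S ↔ Function.update q l (q l - 1) ∈ S)

lemma exists_other_axes : ∀ j : Fin 3, ∃ i l : Fin 3, i ≠ l ∧ i ≠ j ∧ l ≠ j ∧
    ∀ m, m = i ∨ m = l ∨ m = j := by
  decide

lemma singleton_cell_subset_iff {q p : Fin 3 → ℤ} {i l j : Fin 3} (hil : i ≠ l) (hij : i ≠ j)
    (hlj : l ≠ j) (hall : ∀ m, m = i ∨ m = l ∨ m = j) :
    cell q {j} ⊆ cell p {i}ᶜ ↔ p = q ∨ p = Function.update q l (q l - 1) := by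
  rw [cell_subset_iff]
  constructor
  · intro h
    have hi := h i
    have hl := h l
    have hj := h j
    simp [hij, hlj, hij.symm, hil.symm] at hi hl hj
    by_cases hpl : p l = q l
    · left
      funext m
      rcases hall m with rfl | rfl | rfl <;> omega
    · right
      funext m
      rcases hall m with rfl | rfl | rfl
      · simp [hil]; omega
      · simp; omega
      · simp [hlj.symm]; omega
  · rintro (rfl | rfl) m
    · rcases hall m with rfl | rfl | rfl <;> simp [hij, hlj, hij.symm, hil.symm]
    · rcases hall m with rfl | rfl | rfl <;> simp [hij, hlj, hij.symm, hil.symm, hil, hlj.symm]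

/-- The four squares at an edge separate the four cubes around it, cyclically `q`, `qi`, `qil`,
`ql`. Membership in `S` changes an even number of times around the cycle: not 0 times, as the edge
lies on some face, and not 4 times, by `NoDiagonal`. -/
lemma ncard_faces_eq_two {S : Set (Fin 3 → ℤ)} (hS : NoDiagonal S) {e : Set E3}
    (he : e ∈ edges (surfaceOf S)) : {f | f ∈ surfaceOf S ∧ e ∈ polygonEdges f}.ncard = 2 := by
  obtain ⟨f₀, hf₀⟩ : {f | f ∈ surfaceOf S ∧ e ∈ polygonEdges f}.Nonempty :=
    he.imp fun _ h => h
  obtain ⟨q, j, rfl, -⟩ := mem_edges_surfaceOf.1 he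
  obtain ⟨i, l, hil, hij, hlj, hall⟩ := exists_other_axes j
  have hdiag := hS q i l hil
  obtain ⟨qi, hqi⟩ : ∃ x, x = Function.update q i (q i - 1) := ⟨_, rfl⟩
  obtain ⟨ql, hql⟩ : ∃ x, x = Function.update q l (q l - 1) := ⟨_, rfl⟩
  obtain ⟨qil, hqil⟩ : ∃ x, x = Function.update qi l (q l - 1) := ⟨_, rfl⟩
  rw [← hqi, ← hql, ← hqil] at hdiag
  have hqil' : Function.update ql i (q i - 1) = qil := by
    rw [hqil, hql, hqi, Function.update_comm hil]
  have hqli : ql i = q i := by simp [hql, hil]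
  have hqil_l : qi l = q l := by simp [hqi, hil.symm]
  have hset : ∀ f, (f ∈ surfaceOf S ∧ cell q {j} ∈ polygonEdges f) ↔
      (f = cell q {i}ᶜ ∧ ¬(q ∈ S ↔ qi ∈ S)) ∨ (f = cell ql {i}ᶜ ∧ ¬(ql ∈ S ↔ qil ∈ S)) ∨
      (f = cell q {l}ᶜ ∧ ¬(q ∈ S ↔ ql ∈ S)) ∨ (f = cell qi {l}ᶜ ∧ ¬(qi ∈ S ↔ qil ∈ S)) := by
    intro f
    have hm1 : Mixed S q {i}ᶜ ↔ ¬(q ∈ S ↔ qi ∈ S) := by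
      rw [mixed_compl_singleton_iff, hqi]
    have hm2 : Mixed S ql {i}ᶜ ↔ ¬(ql ∈ S ↔ qil ∈ S) := by
      rw [mixed_compl_singleton_iff, hqli, hqil']
    have hm3 : Mixed S q {l}ᶜ ↔ ¬(q ∈ S ↔ ql ∈ S) := by
      rw [mixed_compl_singleton_iff, hql]
    have hm4 : Mixed S qi {l}ᶜ ↔ ¬(qi ∈ S ↔ qil ∈ S) := by
      rw [mixed_compl_singleton_iff, hqil_l, hqil]
    rw [← hm1, ← hm2, ← hm3, ← hm4]
    have hall' : ∀ m, m = l ∨ m = i ∨ m = j := fun m => or_left_comm.1 (hall m)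
    constructor
    · rintro ⟨hf, he⟩
      obtain ⟨p, m, rfl, hp⟩ := mem_surfaceOf.1 hf
      obtain ⟨q', j', hq', hsub⟩ := mem_polygonEdges_cell.1 he
      rw [← hq'] at hsub
      rcases hall m with rfl | rfl | rfl
      · rcases (singleton_cell_subset_iff hil hij hlj hall).1 hsub with h | h
        · exact Or.inl ⟨by rw [h], h ▸ hp⟩
        · exact Or.inr (Or.inl ⟨by rw [h, hql], hql ▸ h ▸ hp⟩)
      · rcases (singleton_cell_subset_iff hil.symm hlj hij hall').1 hsub with h | h
        · exact Or.inr (Or.inr (Or.inl ⟨by rw [h], h ▸ hp⟩))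
        · exact Or.inr (Or.inr (Or.inr ⟨by rw [h, hqi], hqi ▸ h ▸ hp⟩))
      · have := cell_subset_iff.1 hsub m
        simp at this
        omega
    · have h1 : ∀ p, p = q ∨ p = ql → cell q {j} ∈ polygonEdges (cell p {i}ᶜ) := fun p hp =>
        mem_polygonEdges_cell.2 ⟨q, j, rfl, (singleton_cell_subset_iff hil hij hlj hall).2 (hql ▸ hp)⟩
      have h2 : ∀ p, p = q ∨ p = qi → cell q {j} ∈ polygonEdges (cell p {l}ᶜ) := fun p hp =>
        mem_polygonEdges_cell.2 ⟨q, j, rfl,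
          (singleton_cell_subset_iff hil.symm hlj hij hall').2 (hqi ▸ hp)⟩
      rintro (⟨rfl, h⟩ | ⟨rfl, h⟩ | ⟨rfl, h⟩ | ⟨rfl, h⟩)
      · exact ⟨mem_surfaceOf.2 ⟨_, _, rfl, h⟩, h1 _ (Or.inl rfl)⟩
      · exact ⟨mem_surfaceOf.2 ⟨_, _, rfl, h⟩, h1 _ (Or.inr rfl)⟩
      · exact ⟨mem_surfaceOf.2 ⟨_, _, rfl, h⟩, h2 _ (Or.inl rfl)⟩
      · exact ⟨mem_surfaceOf.2 ⟨_, _, rfl, h⟩, h2 _ (Or.inr rfl)⟩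
  have hne1 : q ≠ ql := fun h => by have := congrFun h l; simp [hql] at this; omega
  have hne2 : q ≠ qi := fun h => by have := congrFun h i; simp [hqi] at this; omega
  have hcell : ∀ p p' : Fin 3 → ℤ, cell p {i}ᶜ ≠ cell p' {l}ᶜ := fun p p' h => by
    have := (cell_injective h).2
    rw [compl_inj_iff, Finset.singleton_inj] at this
    exact hil this
  have hc1 : cell q {i}ᶜ ≠ cell ql {i}ᶜ := fun h => hne1 (cell_injective h).1
  have hc2 : cell q {l}ᶜ ≠ cell qi {l}ᶜ := fun h => hne2 (cell_injective h).1
  have hne := (hset f₀).1 hf₀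
  have hset' : {f | f ∈ surfaceOf S ∧ cell q {j} ∈ polygonEdges f} = {f |
      (f = cell q {i}ᶜ ∧ ¬(q ∈ S ↔ qi ∈ S)) ∨ (f = cell ql {i}ᶜ ∧ ¬(ql ∈ S ↔ qil ∈ S)) ∨
      (f = cell q {l}ᶜ ∧ ¬(q ∈ S ↔ ql ∈ S)) ∨ (f = cell qi {l}ᶜ ∧ ¬(qi ∈ S ↔ qil ∈ S))} :=
    Set.ext hset
  rw [hset', Set.ncard_eq_two]
  by_cases b1 : q ∈ S <;> by_cases b2 : qi ∈ S <;> by_cases b3 : ql ∈ S <;>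
    by_cases b4 : qil ∈ S <;>
    simp only [b1, b2, b3, b4, iff_self, iff_true, iff_false,
      not_true_eq_false, not_false_eq_true, and_false, and_true, or_false, false_or,
      forall_const, imp_false] at hdiag hne ⊢
  all_goals first
    | exact ⟨_, _, hc1, rfl⟩
    | exact ⟨_, _, hc2, rfl⟩
    | exact ⟨_, _, hcell _ _, rfl⟩

/-! ### Links -/

/-- In a square with corner `v`, the edge opposite to `v` that is parallel to the `b`-axis. -/
def oppositeEdge (v p : Fin 3 → ℤ) (a b : Fin 3) : Set E3 :=
  cell (Function.update p a (2 * p a - v a + 1)) {b}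

lemma latticePoint_mem_square {v p : Fin 3 → ℤ} {i : Fin 3} :
    latticePoint v ∈ cell p {i}ᶜ ↔ p i = v i ∧ ∀ j, j ≠ i → p j = v j ∨ p j = v j - 1 := by
  rw [latticePoint_mem_cell]
  constructor
  · intro h
    refine ⟨?_, fun j hj => ?_⟩
    · have := h i
      simp at this
      omega
    · have := h j
      simp [hj] at this
      omega
  · rintro ⟨h1, h2⟩ j
    by_cases hj : j = i
    · subst hj
      simp [h1]
    · have := h2 j hj
      simp [hj]
      omega

/-- In a direction `a` of the square, `p a` is `v a` or `v a - 1`, so `2 * p a - v a + 1` is `v a +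
1` or `v a - 1`: the coordinate of the side of the square that is away from `v`. -/
lemma oppositeEdge_mem_link {S : Set (Fin 3 → ℤ)} {v p : Fin 3 → ℤ} {i a b : Fin 3}
    (hp : Mixed S p {i}ᶜ) (hv : latticePoint v ∈ cell p {i}ᶜ) (hab : a ≠ b) (hai : a ≠ i)
    (hbi : b ≠ i) : oppositeEdge v p a b ∈ link (surfaceOf S) (latticePoint v) := by
  have hv' := latticePoint_mem_square.1 hv
  refine ⟨_, mem_surfaceOf.2 ⟨p, i, rfl, hp⟩, mem_polygonEdges_cell.2 ⟨_, b, rfl, ?_⟩,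
    mem_extremePoints_cell.2 ⟨v, rfl, hv⟩, ?_⟩
  · rw [cell_subset_iff]
    intro j
    by_cases hja : j = a
    · subst hja
      have := hv'.2 j hai
      simp [hab, hai]
      omega
    · by_cases hji : j = i
      · subst hji
        simp [hja, hbi.symm]
      · simp [hja, hji]
        split_ifs <;> simp
  · intro h
    have h1 := latticePoint_mem_cell.1 h a
    have := hv'.2 a hai
    simp [hab] at h1
    omega

lemma near_mem_oppositeEdge {v p : Fin 3 → ℤ} {i a b : Fin 3}
    (hv : latticePoint v ∈ cell p {i}ᶜ) (hab : a ≠ b) (hall : ∀ m, m = a ∨ m = b ∨ m = i)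
    (hai : a ≠ i) (hbi : b ≠ i) :
    latticePoint (Function.update v a (2 * p a - v a + 1)) ∈ oppositeEdge v p a b := by
  have hv' := latticePoint_mem_square.1 hv
  unfold oppositeEdge
  rw [latticePoint_mem_cell]
  intro j
  rcases hall j with rfl | rfl | rfl
  · simp [hab]
  · have := hv'.2 j hbi
    simp [hab.symm]
    omega
  · have := hv'.1
    simp [hai.symm, hbi.symm]
    omega

lemma far_mem_oppositeEdge {v p : Fin 3 → ℤ} {i a b : Fin 3}
    (hv : latticePoint v ∈ cell p {i}ᶜ) (hab : a ≠ b) (hall : ∀ m, m = a ∨ m = b ∨ m = i)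
    (hai : a ≠ i) (hbi : b ≠ i) :
    latticePoint (fun j => if j = i then v i else 2 * p j - v j + 1) ∈ oppositeEdge v p a b := by
  have hv' := latticePoint_mem_square.1 hv
  unfold oppositeEdge
  rw [latticePoint_mem_cell]
  intro j
  rcases hall j with rfl | rfl | rfl
  · simp [hab, hai]
  · have := hv'.2 j hbi
    simp [hab.symm, hbi]
    omega
  · have := hv'.1
    simp [hai.symm, hbi.symm]
    omega

lemma exists_oppositeEdge {S : Set (Fin 3 → ℤ)} {v : Fin 3 → ℤ} {e : Set E3}
    (he : e ∈ link (surfaceOf S) (latticePoint v)) :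
    ∃ p i a b, Mixed S p {i}ᶜ ∧ latticePoint v ∈ cell p {i}ᶜ ∧ a ≠ b ∧ a ≠ i ∧ b ≠ i ∧
      (∀ m, m = a ∨ m = b ∨ m = i) ∧ e = oppositeEdge v p a b := by
  obtain ⟨f, hf, he, hvf, hve⟩ := he
  obtain ⟨p, i, rfl, hp⟩ := mem_surfaceOf.1 hf
  obtain ⟨q, b, rfl, hq⟩ := mem_polygonEdges_cell.1 he
  have hv : latticePoint v ∈ cell p {i}ᶜ := hvf.1
  have hv' := latticePoint_mem_square.1 hv
  have hq' := cell_subset_iff.1 hq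
  have hbi : b ≠ i := by
    rintro rfl
    have := hq' b
    simp at this
    omega
  obtain ⟨a, hab, hai, hall⟩ : ∃ a, a ≠ b ∧ a ≠ i ∧ ∀ m, m = a ∨ m = b ∨ m = i := by
    clear * - hbi
    revert b i
    decide
  refine ⟨p, i, a, b, hp, hv, hab, hai, hbi, hall, ?_⟩
  have h1 := hq' i
  have h2 := hq' b
  have h3 := hq' a
  have h4 := hv'.2 b hbi
  have h5 := hv'.2 a hai
  simp [hab, hbi, hai, hbi.symm] at h1 h2 h3
  have hqa : q a ≠ v a := by
    intro hqa
    apply hve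
    rw [latticePoint_mem_cell]
    intro m
    rcases hall m with rfl | rfl | rfl
    · simp [hab, hqa]
    · simp; omega
    · have := hv'.1
      simp [hbi.symm]; omega
  unfold oppositeEdge
  congr 1
  funext m
  rcases hall m with rfl | rfl | rfl
  · simp; omega
  · simp [hab.symm]; omega
  · simp [hai.symm]; omega

/-- The link of a lattice point is connected if the mixed squares at that point are connected
through the edges that contain the point. -/
lemma isConnected_link {S : Set (Fin 3 → ℤ)} {v : Fin 3 → ℤ} (hv : Mixed S v ∅)
    (h : ∀ Φ : Fin 3 → ℤ → Bool,
      (∀ p i, Mixed S p {i}ᶜ → latticePoint v ∈ cell p {i}ᶜ → ∀ a b, a ≠ i → b ≠ i →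
        Φ a (2 * p a - v a + 1) = Φ b (2 * p b - v b + 1)) →
      ∃ r, ∀ p i, Mixed S p {i}ᶜ → latticePoint v ∈ cell p {i}ᶜ → ∀ a, a ≠ i →
        Φ a (2 * p a - v a + 1) = r) :
    IsConnected (⋃₀ link (surfaceOf S) (latticePoint v)) := by
  constructor
  · obtain ⟨p, i, hp, hvp⟩ := hv.exists_square
    rw [cell_empty, Set.singleton_subset_iff] at hvp
    obtain ⟨a, b, hab, hai, hbi, hall⟩ := exists_other_axes i
    exact ⟨_, _, oppositeEdge_mem_link hp hvp hab hai hbi,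
      near_mem_oppositeEdge hvp hab hall hai hbi⟩
  · apply isPreconnected_of_forall_constant
    intro f hf
    have hconst : ∀ e ∈ link (surfaceOf S) (latticePoint v), ∀ x ∈ e, ∀ y ∈ e, f x = f y := by
      intro e he x hx y hy
      have hpre : IsPreconnected e := by
        obtain ⟨p, i, a, b, -, -, -, -, -, -, rfl⟩ := exists_oppositeEdge he
        exact (convex_cell _ _).isPreconnected
      exact hpre.constant (hf.mono (Set.subset_sUnion_of_mem he)) hx hy
    -- The two edges opposite to `v` in a square meet in its far corner, and their other ends are
    -- lattice neighbours of `v`. So a locally constant `f` on the link is determined by its values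
    -- at those neighbours, which become the labels `Φ`.
    have hnear : ∀ p i, Mixed S p {i}ᶜ → latticePoint v ∈ cell p {i}ᶜ → ∀ a, a ≠ i →
        f (latticePoint (Function.update v a (2 * p a - v a + 1))) =
        f (latticePoint (fun j => if j = i then v i else 2 * p j - v j + 1)) := by
      intro p i hp hvp a hai
      obtain ⟨b, hab, hbi, hall⟩ : ∃ b, a ≠ b ∧ b ≠ i ∧ ∀ m, m = a ∨ m = b ∨ m = i := by
        clear * - hai
        revert a i
        decide
      exact hconst _ (oppositeEdge_mem_link hp hvp hab hai hbi) _
        (near_mem_oppositeEdge hvp hab hall hai hbi) _ (far_mem_oppositeEdge hvp hab hall hai hbi)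
    obtain ⟨r, hr⟩ := h (fun a w => f (latticePoint (Function.update v a w)))
      fun p i hp hvp a b hai hbi => (hnear p i hp hvp a hai).trans (hnear p i hp hvp b hbi).symm
    have hall : ∀ x ∈ ⋃₀ link (surfaceOf S) (latticePoint v), f x = r := by
      rintro x ⟨e, he, hx⟩
      obtain ⟨p, i, a, b, hp, hvp, hab, hai, hbi, hall, rfl⟩ := exists_oppositeEdge he
      rw [← hr p i hp hvp a hai]
      exact hconst _ he _ hx _ (near_mem_oppositeEdge hvp hab hall hai hbi)
    intro x hx y hy
    rw [hall x hx, hall y hy]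

/-! ### Towers -/

/-- The cubes of a tower whose level `z` is the product of `X z` and `Y z`. -/
def towerCubes (X Y : ℤ → Finset ℤ) : Set (Fin 3 → ℤ) := {p | p 0 ∈ X (p 2) ∧ p 1 ∈ Y (p 2)}

lemma mem_towerCubes {X Y : ℤ → Finset ℤ} {p : Fin 3 → ℤ} :
    p ∈ towerCubes X Y ↔ p 0 ∈ X (p 2) ∧ p 1 ∈ Y (p 2) := Iff.rfl

/-- Consecutive sets are nested. -/
def Nested (X : ℤ → Finset ℤ) : Prop := ∀ z, X (z - 1) ⊆ X z ∨ X z ⊆ X (z - 1)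

/-- Around a vertical edge the four cubes lie in one level, whose product form excludes a
checkerboard. Around a horizontal edge two levels are involved, and a checkerboard would give each
of their shadows on one axis a point that the other lacks. -/
lemma noDiagonal_towerCubes {X Y : ℤ → Finset ℤ} (hX : Nested X) (hY : Nested Y) :
    NoDiagonal (towerCubes X Y) := by
  intro q i l hil h1 h2
  have hx0 : X (q 2 - 1) ⊆ X (q 2) → (q 0 ∈ X (q 2 - 1) → q 0 ∈ X (q 2)) ∧
    (q 0 - 1 ∈ X (q 2 - 1) → q 0 - 1 ∈ X (q 2)) := fun h => ⟨fun h' => h h', fun h' => h h'⟩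
  have hx1 : X (q 2) ⊆ X (q 2 - 1) → (q 0 ∈ X (q 2) → q 0 ∈ X (q 2 - 1)) ∧
    (q 0 - 1 ∈ X (q 2) → q 0 - 1 ∈ X (q 2 - 1)) := fun h => ⟨fun h' => h h', fun h' => h h'⟩
  have hy0 : Y (q 2 - 1) ⊆ Y (q 2) → (q 1 ∈ Y (q 2 - 1) → q 1 ∈ Y (q 2)) ∧
    (q 1 - 1 ∈ Y (q 2 - 1) → q 1 - 1 ∈ Y (q 2)) := fun h => ⟨fun h' => h h', fun h' => h h'⟩
  have hy1 : Y (q 2) ⊆ Y (q 2 - 1) → (q 1 ∈ Y (q 2) → q 1 ∈ Y (q 2 - 1)) ∧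
    (q 1 - 1 ∈ Y (q 2) → q 1 - 1 ∈ Y (q 2 - 1)) := fun h => ⟨fun h' => h h', fun h' => h h'⟩
  have hX' := hX (q 2)
  have hY' := hY (q 2)
  simp only [mem_towerCubes] at h1 h2 ⊢
  fin_cases i <;> fin_cases l <;> simp at hil h1 h2 ⊢ <;> grind

/-- The combinatorics of the eight cubes at a lattice point. Subscripts 0 and 1 are the two sides
along an axis, primes mark the upper level, and `a`, `b`, `c` label the six neighbours of the point
along the three axes. The twelve squares at the point are the edges of the octahedron on these
neighbours; the mixed ones must form a connected graph. The nested patterns are checked one by one.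
-/
lemma link_pattern {α : Type*} (x0 x1 y0 y1 x0' x1' y0' y1' : Prop)
    (hX : ((x0 → x0') ∧ (x1 → x1')) ∨ ((x0' → x0) ∧ (x1' → x1)))
    (hY : ((y0 → y0') ∧ (y1 → y1')) ∨ ((y0' → y0) ∧ (y1' → y1))) (a0 a1 b0 b1 c0 c1 : α)
    (h1 : ¬(x0 ∧ y0 ↔ x0' ∧ y0') → a0 = b0)
    (h2 : ¬(x0 ∧ y1 ↔ x0' ∧ y1') → a0 = b1)
    (h3 : ¬(x1 ∧ y0 ↔ x1' ∧ y0') → a1 = b0)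
    (h4 : ¬(x1 ∧ y1 ↔ x1' ∧ y1') → a1 = b1)
    (h5 : ¬(x0 ∧ y0 ↔ x1 ∧ y0) → b0 = c0)
    (h6 : ¬(x0 ∧ y1 ↔ x1 ∧ y1) → b1 = c0)
    (h7 : ¬(x0' ∧ y0' ↔ x1' ∧ y0') → b0 = c1)
    (h8 : ¬(x0' ∧ y1' ↔ x1' ∧ y1') → b1 = c1)
    (h9 : ¬(x0 ∧ y0 ↔ x0 ∧ y1) → a0 = c0)
    (h10 : ¬(x1 ∧ y0 ↔ x1 ∧ y1) → a1 = c0)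
    (_h11 : ¬(x0' ∧ y0' ↔ x0' ∧ y1') → a0 = c1)
    (_h12 : ¬(x1' ∧ y0' ↔ x1' ∧ y1') → a1 = c1) :
    ∃ r,
    (¬(x0 ∧ y0 ↔ x0' ∧ y0') → a0 = r) ∧
    (¬(x0 ∧ y1 ↔ x0' ∧ y1') → a0 = r) ∧
    (¬(x1 ∧ y0 ↔ x1' ∧ y0') → a1 = r) ∧
    (¬(x1 ∧ y1 ↔ x1' ∧ y1') → a1 = r) ∧
    (¬(x0 ∧ y0 ↔ x1 ∧ y0) → b0 = r) ∧
    (¬(x0 ∧ y1 ↔ x1 ∧ y1) → b1 = r) ∧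
    (¬(x0' ∧ y0' ↔ x1' ∧ y0') → b0 = r) ∧
    (¬(x0' ∧ y1' ↔ x1' ∧ y1') → b1 = r) ∧
    (¬(x0 ∧ y0 ↔ x0 ∧ y1) → a0 = r) ∧
    (¬(x1 ∧ y0 ↔ x1 ∧ y1) → a1 = r) ∧
    (¬(x0' ∧ y0' ↔ x0' ∧ y1') → a0 = r) ∧
    (¬(x1' ∧ y0' ↔ x1' ∧ y1') → a1 = r) := by
  by_cases e0 : x0 <;> by_cases e1 : x1 <;> by_cases e2 : x0' <;> by_cases e3 : x1' <;>
    simp only [e0, e1, e2, e3, false_imp_iff, imp_false, imp_true_iff,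
      not_true_eq_false, not_false_eq_true, and_true, true_and, and_false, false_and, or_false,
      false_or, iff_false, false_iff, iff_self, and_self, or_self] at * <;>
  by_cases e4 : y0 <;> by_cases e5 : y1 <;> by_cases e6 : y0' <;> by_cases e7 : y1' <;>
    simp only [e4, e5, e6, e7, true_imp_iff, false_imp_iff, imp_false, imp_true_iff,
      not_true_eq_false, not_false_eq_true, and_true, true_and, and_false, or_false,
      false_or, iff_true, iff_false, iff_self, and_self, or_self] at * <;>
    first
      | exact ⟨a0, by grind⟩
      | exact ⟨a1, by grind⟩
      | exact ⟨b0, by grind⟩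

lemma isConnected_link_towerCubes {X Y : ℤ → Finset ℤ} (hX : Nested X) (hY : Nested Y)
    {v : Fin 3 → ℤ} (hv : Mixed (towerCubes X Y) v ∅) :
    IsConnected (⋃₀ link (surfaceOf (towerCubes X Y)) (latticePoint v)) := by
  refine isConnected_link hv fun Φ hΦ => ?_
  obtain ⟨x, y, z, rfl⟩ : ∃ x y z, v = ![x, y, z] :=
    ⟨v 0, v 1, v 2, by funext j; fin_cases j <;> rfl⟩
  have hm0 : ∀ a b c : ℤ, Mixed (towerCubes X Y) ![a, b, c] {0}ᶜ ↔
      ¬(a - 1 ∈ X c ∧ b ∈ Y c ↔ a ∈ X c ∧ b ∈ Y c) := by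
    intro a b c
    refine mixed_compl_singleton_iff.trans (not_congr (iff_comm.trans ?_))
    simp [mem_towerCubes]
  have hm1 : ∀ a b c : ℤ, Mixed (towerCubes X Y) ![a, b, c] {1}ᶜ ↔
      ¬(a ∈ X c ∧ b - 1 ∈ Y c ↔ a ∈ X c ∧ b ∈ Y c) := by
    intro a b c
    refine mixed_compl_singleton_iff.trans (not_congr (iff_comm.trans ?_))
    simp [mem_towerCubes]
  have hm2 : ∀ a b c : ℤ, Mixed (towerCubes X Y) ![a, b, c] {2}ᶜ ↔
      ¬(a ∈ X (c - 1) ∧ b ∈ Y (c - 1) ↔ a ∈ X c ∧ b ∈ Y c) := by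
    intro a b c
    refine mixed_compl_singleton_iff.trans (not_congr (iff_comm.trans ?_))
    simp [mem_towerCubes]
  have hv0 : ∀ a b c : ℤ, latticePoint ![x, y, z] ∈ cell ![a, b, c] {0}ᶜ ↔
      a = x ∧ (b = y ∨ b = y - 1) ∧ (c = z ∨ c = z - 1) := by
    intro a b c
    rw [latticePoint_mem_square, Fin.forall_fin_succ, Fin.forall_fin_two]
    simp
  have hv1 : ∀ a b c : ℤ, latticePoint ![x, y, z] ∈ cell ![a, b, c] {1}ᶜ ↔
      b = y ∧ (a = x ∨ a = x - 1) ∧ (c = z ∨ c = z - 1) := by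
    intro a b c
    rw [latticePoint_mem_square, Fin.forall_fin_succ, Fin.forall_fin_two]
    simp
  have hv2 : ∀ a b c : ℤ, latticePoint ![x, y, z] ∈ cell ![a, b, c] {2}ᶜ ↔
      c = z ∧ (a = x ∨ a = x - 1) ∧ (b = y ∨ b = y - 1) := by
    intro a b c
    rw [latticePoint_mem_square, Fin.forall_fin_succ, Fin.forall_fin_two]
    simp
  have k0 : ∀ b c, (b = y ∨ b = y - 1) → (c = z ∨ c = z - 1) →
      ¬(x - 1 ∈ X c ∧ b ∈ Y c ↔ x ∈ X c ∧ b ∈ Y c) →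
      Φ 1 (2 * b - y + 1) = Φ 2 (2 * c - z + 1) := fun b c hb hc h =>
    hΦ ![x, b, c] 0 ((hm0 _ _ _).2 h) ((hv0 _ _ _).2 ⟨rfl, hb, hc⟩) 1 2 (by decide) (by decide)
  have k1 : ∀ a c, (a = x ∨ a = x - 1) → (c = z ∨ c = z - 1) →
      ¬(a ∈ X c ∧ y - 1 ∈ Y c ↔ a ∈ X c ∧ y ∈ Y c) →
      Φ 0 (2 * a - x + 1) = Φ 2 (2 * c - z + 1) := fun a c ha hc h =>
    hΦ ![a, y, c] 1 ((hm1 _ _ _).2 h) ((hv1 _ _ _).2 ⟨rfl, ha, hc⟩) 0 2 (by decide) (by decide)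
  have k2 : ∀ a b, (a = x ∨ a = x - 1) → (b = y ∨ b = y - 1) →
      ¬(a ∈ X (z - 1) ∧ b ∈ Y (z - 1) ↔ a ∈ X z ∧ b ∈ Y z) →
      Φ 0 (2 * a - x + 1) = Φ 1 (2 * b - y + 1) := fun a b ha hb h =>
    hΦ ![a, b, z] 2 ((hm2 _ _ _).2 h) ((hv2 _ _ _).2 ⟨rfl, ha, hb⟩) 0 1 (by decide) (by decide)
  have hXz : ((x - 1 ∈ X (z - 1) → x - 1 ∈ X z) ∧ (x ∈ X (z - 1) → x ∈ X z)) ∨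
      ((x - 1 ∈ X z → x - 1 ∈ X (z - 1)) ∧ (x ∈ X z → x ∈ X (z - 1))) :=
    (hX z).imp (fun h => ⟨fun h' => h h', fun h' => h h'⟩) fun h => ⟨fun h' => h h', fun h' => h h'⟩
  have hYz : ((y - 1 ∈ Y (z - 1) → y - 1 ∈ Y z) ∧ (y ∈ Y (z - 1) → y ∈ Y z)) ∨
      ((y - 1 ∈ Y z → y - 1 ∈ Y (z - 1)) ∧ (y ∈ Y z → y ∈ Y (z - 1))) :=
    (hY z).imp (fun h => ⟨fun h' => h h', fun h' => h h'⟩) fun h => ⟨fun h' => h h', fun h' => h h'⟩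
  have lx := Or.inl (b := x = x - 1) (Eq.refl x)
  have rx := Or.inr (a := x - 1 = x) (Eq.refl (x - 1))
  have ly := Or.inl (b := y = y - 1) (Eq.refl y)
  have ry := Or.inr (a := y - 1 = y) (Eq.refl (y - 1))
  have lz := Or.inl (b := z = z - 1) (Eq.refl z)
  have rz := Or.inr (a := z - 1 = z) (Eq.refl (z - 1))
  obtain ⟨r, h1, h2, h3, h4, h5, h6, h7, h8, h9, h10, h11, h12⟩ := link_pattern
    (x - 1 ∈ X (z - 1)) (x ∈ X (z - 1)) (y - 1 ∈ Y (z - 1)) (y ∈ Y (z - 1))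
    (x - 1 ∈ X z) (x ∈ X z) (y - 1 ∈ Y z) (y ∈ Y z) hXz hYz
    _ _ _ _ _ _ (k2 _ _ rx ry) (k2 _ _ rx ly) (k2 _ _ lx ry) (k2 _ _ lx ly)
    (k0 _ _ ry rz) (k0 _ _ ly rz) (k0 _ _ ry lz) (k0 _ _ ly lz)
    (k1 _ _ rx rz) (k1 _ _ lx rz) (k1 _ _ rx lz) (k1 _ _ lx lz)
  refine ⟨r, fun p i hp hvp a hai => ?_⟩
  obtain ⟨x', y', z', rfl⟩ : ∃ x y z, p = ![x, y, z] :=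
    ⟨p 0, p 1, p 2, by funext j; fin_cases j <;> rfl⟩
  -- It suffices to treat one direction of each square, since `hΦ` equates the labels of its two
  -- directions.
  have key : ∃ b, b ≠ i ∧ Φ b (2 * ![x', y', z'] b - ![x, y, z] b + 1) = r := by
    have hi : i = 0 ∨ i = 1 ∨ i = 2 := by fin_cases i <;> simp
    rcases hi with rfl | rfl | rfl
    · obtain ⟨rfl, hb, hc⟩ := (hv0 _ _ _).1 hvp
      rw [hm0] at hp
      refine ⟨1, by decide, ?_⟩
      rcases hb with rfl | rfl <;> rcases hc with rfl | rfl
      exacts [h8 hp, h6 hp, h7 hp, h5 hp]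
    · obtain ⟨rfl, ha, hc⟩ := (hv1 _ _ _).1 hvp
      rw [hm1] at hp
      refine ⟨0, by decide, ?_⟩
      rcases ha with rfl | rfl <;> rcases hc with rfl | rfl
      exacts [h12 hp, h10 hp, h11 hp, h9 hp]
    · obtain ⟨rfl, ha, hb⟩ := (hv2 _ _ _).1 hvp
      rw [hm2] at hp
      refine ⟨0, by decide, ?_⟩
      rcases ha with rfl | rfl <;> rcases hb with rfl | rfl
      exacts [h4 hp, h3 hp, h2 hp, h1 hp]
  obtain ⟨b, hbi, hb⟩ := key
  rw [← hb]
  exact hΦ _ i hp hvp a b hai hbi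

lemma isPolyhedralClosedSurface_towerCubes {X Y : ℤ → Finset ℤ} (hX : Nested X) (hY : Nested Y)
    (hfin : (towerCubes X Y).Finite) :
    IsPolyhedralClosedSurface (surfaceOf (towerCubes X Y)) where
  toIsPolyhedron := isPolyhedron_surfaceOf hfin
  two_faces _ he := ncard_faces_eq_two (noDiagonal_towerCubes hX hY) he
  link_connected v hv := by
    obtain ⟨q, rfl, hq⟩ := mem_vertices_surfaceOf.1 hv
    exact isConnected_link_towerCubes hX hY hq

/-! ### Alternating towers -/

/-- The shadow on the first axis of level `z` of a tower of `n` columns whose level `z` has its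
blocks in the boxes `A z`, the blocks being parallel to the second axis for even `z`. -/
noncomputable def levelX (n : ℤ) (A : ℤ → Finset ℤ) (z : ℤ) : Finset ℤ := if Even z then A z else Finset.Ico 0 n

/-- The shadow on the second axis of level `z`. -/
noncomputable def levelY (n : ℤ) (A : ℤ → Finset ℤ) (z : ℤ) : Finset ℤ := if Even z then Finset.Ico 0 n else A z

/-- The cubes of an alternating tower. -/
abbrev alternatingCubes (n : ℤ) (A : ℤ → Finset ℤ) : Set (Fin 3 → ℤ) :=
  towerCubes (levelX n A) (levelY n A)

/-- The axis across the blocks of level `z`. -/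
def across (z : ℤ) : Fin 3 := if Even z then 0 else 1

/-- The axis along the blocks of level `z`. -/
def along (z : ℤ) : Fin 3 := if Even z then 1 else 0

lemma across_add_one (z : ℤ) : across (z + 1) = along z := by
  by_cases h : Even z <;> simp [across, along, h]

lemma along_add_one (z : ℤ) : along (z + 1) = across z := by
  by_cases h : Even z <;> simp [across, along, h]

lemma forall_axis (z : ℤ) {P : Fin 3 → Prop} : (∀ j, P j) ↔ P (across z) ∧ P (along z) ∧ P 2 := by
  rw [Fin.forall_fin_succ, Fin.forall_fin_two]
  by_cases h : Even z
  · simp [across, along, h]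
  · simp [across, along, h]
    tauto

lemma mem_alternatingCubes {n : ℤ} {A : ℤ → Finset ℤ} {p : Fin 3 → ℤ} :
    p ∈ alternatingCubes n A ↔
      p (across (p 2)) ∈ A (p 2) ∧ 0 ≤ p (along (p 2)) ∧ p (along (p 2)) < n := by
  rw [mem_towerCubes]
  by_cases h : Even (p 2)
  · simp [levelX, levelY, across, along, h]
  · simp [levelX, levelY, across, along, h]
    tauto

/-- The lattice point with coordinates `a` across and `b` along the blocks of level `z`, and with
height `c`. -/
def levelPoint (z a b c : ℤ) : Fin 3 → ℤ :=
  fun j => if j = 2 then c else if j = across z then a else b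

@[simp] lemma levelPoint_across (z a b c : ℤ) : levelPoint z a b c (across z) = a := by
  by_cases h : Even z <;> simp [levelPoint, across, h]

@[simp] lemma levelPoint_along (z a b c : ℤ) : levelPoint z a b c (along z) = b := by
  by_cases h : Even z <;> simp [levelPoint, across, along, h]

@[simp] lemma levelPoint_two (z a b c : ℤ) : levelPoint z a b c 2 = c := rfl

lemma eq_levelPoint (z : ℤ) (p : Fin 3 → ℤ) : p = levelPoint z (p (across z)) (p (along z)) (p 2) :=
  funext <| (forall_axis z).2 ⟨by simp, by simp, by simp⟩

lemma levelPoint_succ (z a b c : ℤ) : levelPoint (z + 1) a b c = levelPoint z b a c := by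
  have h1 : levelPoint (z + 1) a b c (along z) = a := by rw [← across_add_one]; simp
  have h2 : levelPoint (z + 1) a b c (across z) = b := by rw [← along_add_one]; simp
  rw [eq_levelPoint z (levelPoint (z + 1) a b c), h1, h2, levelPoint_two]

lemma across_ne_along (z : ℤ) : across z ≠ along z := by
  unfold across along
  split_ifs <;> simp

lemma across_ne_two (z : ℤ) : across z ≠ 2 := by
  unfold across
  split_ifs <;> simp

lemma along_ne_two (z : ℤ) : along z ≠ 2 := by
  unfold along
  split_ifs <;> simp

@[simp] lemma update_levelPoint_across (z a b c t : ℤ) :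
    Function.update (levelPoint z a b c) (across z) t = levelPoint z t b c :=
  funext <| (forall_axis z).2
    ⟨by simp, by simp [(across_ne_along z).symm], by simp [(across_ne_two z).symm]⟩

@[simp] lemma update_levelPoint_along (z a b c t : ℤ) :
    Function.update (levelPoint z a b c) (along z) t = levelPoint z a t c :=
  funext <| (forall_axis z).2
    ⟨by simp [across_ne_along z], by simp, by simp [(along_ne_two z).symm]⟩

@[simp] lemma update_levelPoint_two (z a b c t : ℤ) :
    Function.update (levelPoint z a b c) 2 t = levelPoint z a b t :=
  funext <| (forall_axis z).2 ⟨by simp [across_ne_two z], by simp [along_ne_two z], by simp⟩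

section
variable {n : ℤ} {A : ℤ → Finset ℤ}

lemma levelPoint_mem {z a b : ℤ} :
    levelPoint z a b z ∈ alternatingCubes n A ↔ a ∈ A z ∧ 0 ≤ b ∧ b < n := by
  simp [mem_alternatingCubes]

/-- The level above or below is turned by 90°, so the two horizontal coordinates exchange their
roles. -/
lemma levelPoint_mem_of_adjacent {z a b c : ℤ} (hc : c = z - 1 ∨ c = z + 1) :
    levelPoint z a b c ∈ alternatingCubes n A ↔ b ∈ A c ∧ 0 ≤ a ∧ a < n := by
  have h : levelPoint z a b c = levelPoint c b a c := by
    rcases hc with rfl | rfl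
    · conv_lhs => rw [← sub_add_cancel z 1, levelPoint_succ, sub_add_cancel]
    · rw [levelPoint_succ]
  rw [h, levelPoint_mem]

/-! ### Connectedness of the boundary of an alternating tower -/

/-- A box with lattice corners, described in the coordinates of level `z`. -/
def levelBox (z u u' v v' w w' : ℤ) : Set E3 :=
  {x | ((u : ℝ) ≤ x (across z) ∧ x (across z) ≤ u') ∧ ((v : ℝ) ≤ x (along z) ∧ x (along z) ≤ v') ∧
    ((w : ℝ) ≤ x 2 ∧ x 2 ≤ w')}

lemma convex_levelBox (z u u' v v' w w' : ℤ) : Convex ℝ (levelBox z u u' v v' w w') := by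
  have key : ∀ (j : Fin 3) (c d : ℝ), Convex ℝ {x : E3 | c ≤ x j ∧ x j ≤ d} := fun j c d =>
    (convex_Icc c d).linear_preimage (EuclideanSpace.proj (𝕜 := ℝ) j).toLinearMap
  exact (key _ _ _).inter ((key _ _ _).inter (key _ _ _))

lemma latticePoint_mem_levelBox {z u u' v v' w w' a b c : ℤ} :
    latticePoint (levelPoint z a b c) ∈ levelBox z u u' v v' w w' ↔
      (u ≤ a ∧ a ≤ u') ∧ (v ≤ b ∧ b ≤ v') ∧ (w ≤ c ∧ c ≤ w') := by
  simp [levelBox]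

lemma cell_levelPoint (z a b c : ℤ) :
    cell (levelPoint z a b c) Finset.univ = levelBox z a (a + 1) b (b + 1) c (c + 1) := by
  ext x
  rw [cell, Set.mem_ofPred_eq, forall_axis z]
  simp [levelBox]

/-- The floor of `t` works except at the right end, where it would leave the range and `r - 1` is
used. -/
lemma exists_int_near {l r : ℤ} (hlr : l < r) {t : ℝ} (h1 : (l : ℝ) ≤ t) (h2 : t ≤ r) :
    ∃ m, l ≤ m ∧ m < r ∧ (m : ℝ) ≤ t ∧ t ≤ m + 1 := by
  rcases h2.lt_or_eq with h | rfl
  · exact ⟨⌊t⌋, Int.le_floor.2 h1, Int.floor_lt.2 h, Int.floor_le t, (Int.lt_floor_add_one t).le⟩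
  · refine ⟨r - 1, by omega, by omega, ?_, ?_⟩ <;> push_cast <;> linarith

lemma levelBox_subset_frontier {z u u' v v' w w' : ℤ}
    (h : ∀ x ∈ levelBox z u u' v v' w w', ∃ a b c a' b' c',
      levelPoint z a b c ∈ alternatingCubes n A ∧ levelPoint z a' b' c' ∉ alternatingCubes n A ∧
      x ∈ levelBox z a (a + 1) b (b + 1) c (c + 1) ∧
      x ∈ levelBox z a' (a' + 1) b' (b' + 1) c' (c' + 1)) :
    levelBox z u u' v v' w w' ⊆ frontier (solidOf (alternatingCubes n A)) := by
  intro x hx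
  obtain ⟨a, b, c, a', b', c', h1, h2, h3, h4⟩ := h x hx
  rw [← cell_levelPoint] at h3 h4
  exact mem_frontier_solidOf.2 ⟨⟨_, h1, h3⟩, _, h2, h4⟩

/-- The side of a row of blocks, seen from the side of `l - 1`. -/
lemma leftWall_subset_frontier (hn : 0 < n) {z l : ℤ} (hl : l ∈ A z) (hl' : l - 1 ∉ A z) :
    levelBox z l l 0 n z (z + 1) ⊆ frontier (solidOf (alternatingCubes n A)) := by
  refine levelBox_subset_frontier fun x ⟨⟨h1, h2⟩, ⟨h3, h4⟩, h5, h6⟩ => ?_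
  obtain ⟨b, hb, hb', hb1, hb2⟩ := exists_int_near hn h3 h4
  refine ⟨l, b, z, l - 1, b, z, levelPoint_mem.2 ⟨hl, hb, hb'⟩, fun h => hl' (levelPoint_mem.1 h).1,
    ?_, ?_⟩ <;>
  · push_cast [levelBox, Set.mem_ofPred_eq] at h6 ⊢
    refine ⟨⟨?_, ?_⟩, ⟨?_, ?_⟩, ?_, ?_⟩ <;> linarith

lemma rightWall_subset_frontier (hn : 0 < n) {z l : ℤ} (hl : l ∉ A z) (hl' : l - 1 ∈ A z) :
    levelBox z l l 0 n z (z + 1) ⊆ frontier (solidOf (alternatingCubes n A)) := by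
  refine levelBox_subset_frontier fun x ⟨⟨h1, h2⟩, ⟨h3, h4⟩, h5, h6⟩ => ?_
  obtain ⟨b, hb, hb', hb1, hb2⟩ := exists_int_near hn h3 h4
  refine ⟨l - 1, b, z, l, b, z, levelPoint_mem.2 ⟨hl', hb, hb'⟩, fun h => hl (levelPoint_mem.1 h).1,
    ?_, ?_⟩ <;>
  · push_cast [levelBox, Set.mem_ofPred_eq] at h6 ⊢
    refine ⟨⟨?_, ?_⟩, ⟨?_, ?_⟩, ?_, ?_⟩ <;> linarith

lemma endWall_subset_frontier (hn : 0 < n) {z l a b : ℤ} (hla : l ≤ a)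
    (hl : ∀ m, l ≤ m → m ≤ a → m ∈ A z) (hb : b = 0 ∨ b = n) :
    levelBox z l (a + 1) b b z (z + 1) ⊆ frontier (solidOf (alternatingCubes n A)) := by
  refine levelBox_subset_frontier fun x ⟨⟨h1, h2⟩, ⟨h3, h4⟩, h5, h6⟩ => ?_
  obtain ⟨m, hm, hm', hm1, hm2⟩ := exists_int_near (by omega) h1 h2
  have hmA : m ∈ A z := hl m hm (by omega)
  rcases hb with rfl | rfl
  · refine ⟨m, 0, z, m, -1, z, levelPoint_mem.2 ⟨hmA, by omega, by omega⟩, fun h => ?_, ?_, ?_⟩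
    · have := (levelPoint_mem.1 h).2
      omega
    all_goals
      push_cast [levelBox, Set.mem_ofPred_eq] at h3 h4 h6 ⊢
      refine ⟨⟨?_, ?_⟩, ⟨?_, ?_⟩, ?_, ?_⟩ <;> linarith
  · refine ⟨m, b - 1, z, m, b, z, levelPoint_mem.2 ⟨hmA, by omega, by omega⟩, fun h => ?_, ?_, ?_⟩
    · have := (levelPoint_mem.1 h).2
      omega
    all_goals
      push_cast [levelBox, Set.mem_ofPred_eq] at h3 h4 h6 ⊢
      refine ⟨⟨?_, ?_⟩, ⟨?_, ?_⟩, ?_, ?_⟩ <;> linarith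

/-- The part of the top or the bottom of a row of blocks of level `z` that faces the empty box `b`
of an adjacent level. -/
lemma strip_subset_frontier {z l a b c h : ℤ} (hla : l ≤ a)
    (hl : ∀ m, l ≤ m → m ≤ a → m ∈ A z) (hb : 0 ≤ b ∧ b < n) (hbc : b ∉ A c)
    (hc : c = z - 1 ∧ h = z ∨ c = z + 1 ∧ h = z + 1) :
    levelBox z l (a + 1) b (b + 1) h h ⊆ frontier (solidOf (alternatingCubes n A)) := by
  refine levelBox_subset_frontier fun x ⟨⟨h1, h2⟩, ⟨h3, h4⟩, h5, h6⟩ => ?_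
  obtain ⟨m, hm, hm', hm1, hm2⟩ := exists_int_near (by omega) h1 h2
  have hmA : m ∈ A z := hl m hm (by omega)
  have hcz : c = z - 1 ∨ c = z + 1 := by omega
  refine ⟨m, b, z, m, b, c, levelPoint_mem.2 ⟨hmA, hb⟩,
    fun h => hbc ((levelPoint_mem_of_adjacent hcz).1 h).1, ?_, ?_⟩ <;>
  · rcases hc with ⟨rfl, rfl⟩ | ⟨rfl, rfl⟩ <;>
    · push_cast [levelBox, Set.mem_ofPred_eq] at h4 h5 h6 ⊢
      refine ⟨⟨?_, ?_⟩, ⟨?_, ?_⟩, ?_, ?_⟩ <;> linarith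

lemma exists_run {B : Finset ℤ} (hB : ∀ a ∈ B, 0 ≤ a) {a : ℤ} (ha : a ∈ B) :
    ∃ l ≤ a, (∀ m, l ≤ m → m ≤ a → m ∈ B) ∧ l - 1 ∉ B := by
  -- The run begins just after the last missing integer up to `a`; `-1` is a missing integer, so
  -- there is one.
  obtain ⟨u, ⟨hu, huB⟩, hmax⟩ := Int.exists_greatest_of_bdd (P := fun m => m ≤ a ∧ m ∉ B)
    ⟨a, fun z hz => hz.1⟩ ⟨-1, by linarith [hB a ha], fun h => by have := hB _ h; omega⟩
  have hne : u ≠ a := fun h => huB (h ▸ ha)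
  refine ⟨u + 1, by omega, fun m hm hma => ?_, by simpa using huB⟩
  by_contra hmB
  have := hmax m ⟨hma, hmB⟩
  omega

/-- The boundary of an alternating tower is connected. -/
lemma isConnected_frontier_alternating (hn : 0 < n) (hA : ∀ z, ∀ a ∈ A z, 0 ≤ a ∧ a < n) {L : ℤ}
    (hL : 2 ≤ L) (hne : ∀ z, (A z).Nonempty ↔ 0 ≤ z ∧ z < L) :
    IsConnected (frontier (solidOf (alternatingCubes n A))) := by
  have hrun : ∀ z, ∀ a ∈ A z, ∃ l ≤ a, (∀ m, l ≤ m → m ≤ a → m ∈ A z) ∧ l - 1 ∉ A z :=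
    fun z a ha => exists_run (fun b hb => (hA z b hb).1) ha
  have hleft : ∀ z, 0 ≤ z → z < L → ∃ l, l ∈ A z ∧ l - 1 ∉ A z := by
    intro z h0 h1
    obtain ⟨a, ha⟩ := (hne z).2 ⟨h0, h1⟩
    obtain ⟨l, hla, hl, hl'⟩ := hrun z a ha
    exact ⟨l, hl l le_rfl hla, hl'⟩
  obtain ⟨l₀, hl₀, hl₀'⟩ := hleft 0 le_rfl (by omega)
  constructor
  · refine ⟨latticePoint (levelPoint 0 l₀ 0 0), leftWall_subset_frontier hn hl₀ hl₀' ?_⟩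
    rw [latticePoint_mem_levelBox]
    omega
  apply isPreconnected_of_forall_constant
  intro f hf
  have hconst : ∀ z u u' v v' w w', levelBox z u u' v v' w w' ⊆
      frontier (solidOf (alternatingCubes n A)) →
      ∀ x ∈ levelBox z u u' v v' w w', ∀ y ∈ levelBox z u u' v v' w w', f x = f y :=
    fun z u u' v v' w w' h x hx y hy =>
      (convex_levelBox z u u' v v' w w').isPreconnected.constant (hf.mono h) hx hy
  -- The left walls of a run at `l` in level `z` and of a run at `l'` in level `z + 1` are
  -- perpendicular and span the whole width of the tower, so they share the point over `(l, l')` at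
  -- height `z + 1`.
  have hstep : ∀ z l l', l ∈ A z → l - 1 ∉ A z → l' ∈ A (z + 1) → l' - 1 ∉ A (z + 1) →
      f (latticePoint (levelPoint z l 0 z)) =
        f (latticePoint (levelPoint (z + 1) l' 0 (z + 1))) := by
    intro z l l' hl hl1 hl' hl1'
    have b1 := hA z l hl
    have b2 := hA (z + 1) l' hl'
    trans f (latticePoint (levelPoint z l l' (z + 1)))
    · apply hconst _ _ _ _ _ _ _ (leftWall_subset_frontier hn hl hl1) <;>
        rw [latticePoint_mem_levelBox] <;> omega
    · rw [← levelPoint_succ]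
      apply hconst _ _ _ _ _ _ _ (leftWall_subset_frontier hn hl' hl1') <;>
        rw [latticePoint_mem_levelBox] <;> omega
  obtain ⟨r, hr⟩ : ∃ r, ∀ z l, l ∈ A z → l - 1 ∉ A z →
      f (latticePoint (levelPoint z l 0 z)) = r := by
    refine ⟨f (latticePoint (levelPoint 0 l₀ 0 0)), ?_⟩
    have hup : ∀ z : ℤ, 1 ≤ z → z < L → ∀ l, l ∈ A z → l - 1 ∉ A z →
        f (latticePoint (levelPoint z l 0 z)) = f (latticePoint (levelPoint 0 l₀ 0 0)) := by
      intro z hz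
      induction z, hz using Int.leInduction with
      | base => exact fun _ l hl hl' => (hstep 0 l₀ l hl₀ hl₀' hl hl').symm
      | succ z hz ih =>
        intro hzL l hl hl'
        obtain ⟨m, hm, hm'⟩ := hleft z (by omega) (by omega)
        rw [← hstep z m l hm hm' hl hl']
        exact ih (by omega) m hm hm'
    intro z l hl hl'
    obtain ⟨h0, h1⟩ := (hne z).1 ⟨l, hl⟩
    rcases h0.lt_or_eq with h0 | rfl
    · exact hup z (by omega) h1 l hl hl'
    -- Two runs of the bottom level are linked only through the level above; here the tower needs
    -- two levels.
    · obtain ⟨m, hm, hm'⟩ := hleft 1 (by omega) (by omega)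
      rw [hstep 0 l m hl hl' hm hm']
      exact hup 1 le_rfl (by omega) m hm hm'
  have hwall : ∀ z l, l ∈ A z → l - 1 ∉ A z → ∀ x ∈ levelBox z l l 0 n z (z + 1), f x = r := by
    intro z l hl hl' x hx
    rw [← hr z l hl hl']
    apply hconst _ _ _ _ _ _ _ (leftWall_subset_frontier hn hl hl') x hx
    rw [latticePoint_mem_levelBox]
    omega
  -- End walls and horizontal strips extend back to the left end of their run and touch its left
  -- wall; a right wall touches the end wall of the same run.
  have hend : ∀ z, ∀ a ∈ A z, ∀ b, b = 0 ∨ b = n →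
      ∀ x ∈ levelBox z a (a + 1) b b z (z + 1), f x = r := by
    intro z a ha b hb x hx
    obtain ⟨l, hla, hl, hl'⟩ := hrun z a ha
    rw [← hwall z l (hl l le_rfl hla) hl' (latticePoint (levelPoint z l b z))
      (latticePoint_mem_levelBox.2 (by omega))]
    apply hconst _ _ _ _ _ _ _ (endWall_subset_frontier hn hla hl hb)
    · have : (l : ℝ) ≤ a := by exact_mod_cast hla
      exact ⟨⟨this.trans hx.1.1, hx.1.2⟩, hx.2⟩
    · rw [latticePoint_mem_levelBox]
      omega
  have hside : ∀ z a, ¬(a ∈ A z ↔ a - 1 ∈ A z) →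
      ∀ x ∈ levelBox z a a 0 n z (z + 1), f x = r := by
    intro z a ha x hx
    by_cases haz : a ∈ A z
    · exact hwall z a haz (by tauto) x hx
    · have ha' : a - 1 ∈ A z := by tauto
      rw [← hend z (a - 1) ha' 0 (Or.inl rfl) (latticePoint (levelPoint z a 0 z))
        (latticePoint_mem_levelBox.2 (by omega))]
      apply hconst _ _ _ _ _ _ _ (rightWall_subset_frontier hn haz ha') x hx
      rw [latticePoint_mem_levelBox]
      omega
  have hflat : ∀ z, ∀ a ∈ A z, ∀ b, 0 ≤ b ∧ b < n → ∀ c h, b ∉ A c →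
      (c = z - 1 ∧ h = z ∨ c = z + 1 ∧ h = z + 1) →
      ∀ x ∈ levelBox z a (a + 1) b (b + 1) h h, f x = r := by
    intro z a ha b hb c h hbc hc x hx
    obtain ⟨l, hla, hl, hl'⟩ := hrun z a ha
    rw [← hwall z l (hl l le_rfl hla) hl' (latticePoint (levelPoint z l b h))
      (latticePoint_mem_levelBox.2 (by omega))]
    apply hconst _ _ _ _ _ _ _ (strip_subset_frontier hla hl hb hbc hc)
    · have : (l : ℝ) ≤ a := by exact_mod_cast hla
      exact ⟨⟨this.trans hx.1.1, hx.1.2⟩, hx.2⟩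
    · rw [latticePoint_mem_levelBox]
      omega
  have hall : ∀ x ∈ frontier (solidOf (alternatingCubes n A)), f x = r := by
    intro x hx
    rw [← sUnion_surfaceOf] at hx
    obtain ⟨_, hsq, hx⟩ := hx
    obtain ⟨p, i, rfl, hp⟩ := mem_surfaceOf.1 hsq
    rw [mixed_compl_singleton_iff] at hp
    -- Any unit square of the boundary is a piece of a side wall, an end wall or a strip, according
    -- to its normal in the coordinates of its own level.
    obtain ⟨z, a, b, rfl⟩ : ∃ z a b, p = levelPoint z a b z := ⟨_, _, _, eq_levelPoint (p 2) p⟩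
    have hx' := (forall_axis z).1 hx
    have hi : i = across z ∨ i = along z ∨ i = 2 := by
      revert i
      rw [forall_axis z]
      simp
    rcases hi with rfl | rfl | rfl
    · rw [levelPoint_across, update_levelPoint_across, levelPoint_mem, levelPoint_mem] at hp
      have hb : 0 ≤ b ∧ b < n := by tauto
      refine hside z a (by tauto) x ?_
      have hb0 : (0 : ℝ) ≤ b := by exact_mod_cast hb.1
      have hbn : (b : ℝ) + 1 ≤ n := by exact_mod_cast Int.add_one_le_iff.2 hb.2
      simp [(across_ne_along z).symm, (across_ne_two z).symm] at hx'
      refine ⟨?_, ⟨?_, ?_⟩, ?_⟩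
      · exact hx'.1
      · push_cast
        exact hb0.trans hx'.2.1.1
      · exact hx'.2.1.2.trans hbn
      · push_cast
        exact hx'.2.2
    · rw [levelPoint_along, update_levelPoint_along, levelPoint_mem, levelPoint_mem] at hp
      have ha : a ∈ A z := by tauto
      have hb : b = 0 ∨ b = n := by
        simp only [ha, true_and] at hp
        omega
      refine hend z a ha b hb x ?_
      simp [across_ne_along, (along_ne_two z).symm] at hx'
      refine ⟨?_, ?_, ?_⟩
      · push_cast
        exact hx'.1
      · exact hx'.2.1
      · push_cast
        exact hx'.2.2
    · rw [levelPoint_two, update_levelPoint_two, levelPoint_mem,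
        levelPoint_mem_of_adjacent (Or.inl rfl)] at hp
      simp [across_ne_two z, along_ne_two z] at hx'
      -- Either the cube above the square is filled, and the square is on the underside of level
      -- `z`, or the cube below is, and the square is on the top of level `z - 1`.
      by_cases hz : a ∈ A z ∧ 0 ≤ b ∧ b < n
      · have hb : b ∉ A (z - 1) := fun h => hp ⟨fun _ => ⟨h, hA z a hz.1⟩, fun _ => hz⟩
        refine hflat z a hz.1 b hz.2 (z - 1) z hb (Or.inl ⟨rfl, rfl⟩) x ⟨?_, ?_, ?_⟩
        · push_cast
          exact hx'.1
        · push_cast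
          exact hx'.2.1
        · exact hx'.2.2
      · have hb : b ∈ A (z - 1) ∧ 0 ≤ a ∧ a < n := by tauto
        have ha : a ∉ A z := fun h => hz ⟨h, hA _ b hb.1⟩
        refine hflat (z - 1) b hb.1 a hb.2 z z ha (Or.inr ⟨by ring, by ring⟩) x ?_
        have e1 : along (z - 1) = across z := by rw [← across_add_one, sub_add_cancel]
        have e2 : across (z - 1) = along z := by rw [← along_add_one, sub_add_cancel]
        rw [levelBox, Set.mem_ofPred_eq, e1, e2]
        push_cast
        exact ⟨hx'.2.1, hx'.1, hx'.2.2⟩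
  intro x hx y hy
  rw [hall x hx, hall y hy]

end

/-! ### Counting the mixed cells of a tower -/

/-- The lowest corners of the one-dimensional lattice cells (points or unit intervals, depending on
the flag) that meet one of the unit intervals with left ends in `X`. -/
noncomputable def grow (isInterval : Bool) (X : Finset ℤ) : Finset ℤ :=
  if isInterval then X else X ∪ X.image (· + 1)

/-- The lowest corners of the one-dimensional lattice cells (points or unit intervals, depending on
the flag) that lie only in unit intervals with left ends in `X`. -/
noncomputable def shrink (isInterval : Bool) (X : Finset ℤ) : Finset ℤ :=
  if isInterval then X else X ∩ X.image (· + 1)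

/-- The number of maximal runs of consecutive integers in `X`. -/
noncomputable def numRuns (X : Finset ℤ) : ℕ := (X.filter fun a => a + 1 ∉ X).card

lemma mem_grow {d : Bool} {X : Finset ℤ} {a : ℤ} :
    a ∈ grow d X ↔ a ∈ X ∨ (d = false ∧ a - 1 ∈ X) := by
  cases d <;> simp [grow, sub_eq_add_neg]

lemma mem_shrink {d : Bool} {X : Finset ℤ} {a : ℤ} :
    a ∈ shrink d X ↔ a ∈ X ∧ (d = false → a - 1 ∈ X) := by
  cases d <;> simp [shrink, sub_eq_add_neg]

lemma grow_mono (d : Bool) {X X' : Finset ℤ} (h : X ⊆ X') : grow d X ⊆ grow d X' := by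
  intro a ha
  rw [mem_grow] at ha ⊢
  exact ha.imp (fun h' => h h') (And.imp_right fun h' => h h')

lemma shrink_subset_grow (d : Bool) (X : Finset ℤ) : shrink d X ⊆ grow d X := by
  intro a ha
  rw [mem_shrink] at ha
  exact mem_grow.2 (Or.inl ha.1)

/-- Nestedness is essential: the neighbouring intervals of `{0}` and `{1}` share an endpoint
although the sets are disjoint. -/
lemma grow_inter (d : Bool) {X X' : Finset ℤ} (h : X' ⊆ X ∨ X ⊆ X') :
    grow d X ∩ grow d X' = grow d (X ∩ X') := by
  rcases h with h | h
  · rw [Finset.inter_eq_right.2 h, Finset.inter_eq_right.2 (grow_mono d h)]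
  · rw [Finset.inter_eq_left.2 h, Finset.inter_eq_left.2 (grow_mono d h)]

lemma shrink_inter (d : Bool) (X X' : Finset ℤ) :
    shrink d X ∩ shrink d X' = shrink d (X ∩ X') := by
  ext a
  simp only [Finset.mem_inter, mem_shrink]
  tauto

/-- A run of `m` unit intervals has `m + 1` lattice points, one more than its left ends; likewise `m
- 1` of them are interior, whence `card_shrink_false`. -/
lemma card_grow_false (X : Finset ℤ) : ((grow false X).card : ℤ) = X.card + numRuns X := by
  have h : grow false X = X ∪ (X.filter fun a => a + 1 ∉ X).image (· + 1) := by
    ext a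
    simp only [mem_grow, Finset.mem_union, Finset.mem_image, Finset.mem_filter, true_and]
    constructor
    · rintro (h | h)
      · exact Or.inl h
      · by_cases ha : a ∈ X
        · exact Or.inl ha
        · exact Or.inr ⟨a - 1, ⟨h, by simpa using ha⟩, by ring⟩
    · rintro (h | ⟨b, ⟨hb, -⟩, rfl⟩)
      · exact Or.inl h
      · right; simpa using hb
  rw [h, Finset.card_union_of_disjoint, Finset.card_image_of_injective _ (add_left_injective 1)]
  · push_cast
    rfl
  · rw [Finset.disjoint_left]
    rintro a ha h
    obtain ⟨b, hb, rfl⟩ := Finset.mem_image.1 h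
    exact (Finset.mem_filter.1 hb).2 ha

lemma card_shrink_false (X : Finset ℤ) : ((shrink false X).card : ℤ) = X.card - numRuns X := by
  have h1 := Finset.card_union_add_card_inter X (X.image (· + 1))
  rw [Finset.card_image_of_injective _ (add_left_injective 1)] at h1
  have h2 := card_grow_false X
  simp only [grow, shrink, Bool.false_eq_true, if_false] at h2 ⊢
  omega

lemma card_grow_true (X : Finset ℤ) : ((grow true X).card : ℤ) = X.card := by simp [grow]

lemma card_shrink_true (X : Finset ℤ) : ((shrink true X).card : ℤ) = X.card := by simp [shrink]

section
variable (X Y : ℤ → Finset ℤ)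

/-- The cells at height `z`, of the type given by the flags, that lie in a cube of the tower. -/
noncomputable def touching (d₀ d₁ d₂ : Bool) (z : ℤ) : Finset (ℤ × ℤ) :=
  if d₂ then grow d₀ (X z) ×ˢ grow d₁ (Y z)
  else grow d₀ (X z) ×ˢ grow d₁ (Y z) ∪ grow d₀ (X (z - 1)) ×ˢ grow d₁ (Y (z - 1))

/-- The cells at height `z`, of the type given by the flags, that lie only in cubes of the tower. -/
noncomputable def enclosed (d₀ d₁ d₂ : Bool) (z : ℤ) : Finset (ℤ × ℤ) :=
  if d₂ then shrink d₀ (X z) ×ˢ shrink d₁ (Y z)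
  else (shrink d₀ (X z) ×ˢ shrink d₁ (Y z)) ∩ (shrink d₀ (X (z - 1)) ×ˢ shrink d₁ (Y (z - 1)))

variable {X Y}

lemma exists_cube_iff {Q : (Fin 3 → ℤ) → Prop} {a b z : ℤ} {D : Finset (Fin 3)} :
    (∃ c, Q c ∧ cell ![a, b, z] D ⊆ cell c Finset.univ) ↔
      ∃ a' b' z', Q ![a', b', z'] ∧ (a' = a ∨ (0 ∉ D ∧ a' = a - 1)) ∧
        (b' = b ∨ (1 ∉ D ∧ b' = b - 1)) ∧ (z' = z ∨ (2 ∉ D ∧ z' = z - 1)) := by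
  have key : ∀ a' b' z', cell ![a, b, z] D ⊆ cell ![a', b', z'] Finset.univ ↔
      (a' = a ∨ (0 ∉ D ∧ a' = a - 1)) ∧
        (b' = b ∨ (1 ∉ D ∧ b' = b - 1)) ∧ (z' = z ∨ (2 ∉ D ∧ z' = z - 1)) := by
    intro a' b' z'
    have e : ∀ s t : ℤ, s = t + 1 ↔ t = s - 1 := fun s t => by omega
    rw [cell_subset_cube_iff, Fin.forall_fin_succ, Fin.forall_fin_two, eq_comm (a := a'),
      eq_comm (a := b'), eq_comm (a := z'), ← e, ← e, ← e]
    rfl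
  constructor
  · rintro ⟨c, hc, h⟩
    obtain ⟨a', b', z', rfl⟩ : ∃ x y z, c = ![x, y, z] :=
      ⟨c 0, c 1, c 2, by funext j; fin_cases j <;> rfl⟩
    exact ⟨a', b', z', hc, (key _ _ _).1 h⟩
  · rintro ⟨a', b', z', hc, h⟩
    exact ⟨_, hc, (key _ _ _).2 h⟩

/-- A mixed cell touches the tower and is not enclosed by it. A cell that does not extend vertically
lies between the levels `z - 1` and `z`, so both enter. -/
lemma mixed_iff_mem_slice {D : Finset (Fin 3)} {a b z : ℤ} :
    Mixed (towerCubes X Y) ![a, b, z] D ↔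
      (a, b) ∈ touching X Y (decide (0 ∈ D)) (decide (1 ∈ D)) (decide (2 ∈ D)) z \
        enclosed X Y (decide (0 ∈ D)) (decide (1 ∈ D)) (decide (2 ∈ D)) z := by
  have h1 : (∃ c, c ∈ towerCubes X Y ∧ cell ![a, b, z] D ⊆ cell c Finset.univ) ↔
      (a, b) ∈ touching X Y (decide (0 ∈ D)) (decide (1 ∈ D)) (decide (2 ∈ D)) z := by
    rw [exists_cube_iff]
    unfold touching
    by_cases h2 : 2 ∈ D
    · simp only [h2, decide_true, if_true, Finset.mem_product, mem_grow, decide_eq_false_iff_not,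
        not_true_eq_false, false_and, or_false, mem_towerCubes]
      constructor
      · rintro ⟨a', b', z', ⟨ha, hb⟩, ha', hb', rfl⟩
        simp at ha hb
        rcases ha' with rfl | ⟨h0, rfl⟩ <;> rcases hb' with rfl | ⟨h1, rfl⟩ <;> simp [*]
      · rintro ⟨ha | ⟨h0, ha⟩, hb | ⟨h1, hb⟩⟩
        exacts [⟨a, b, z, ⟨ha, hb⟩, Or.inl rfl, Or.inl rfl, rfl⟩,
          ⟨a, b - 1, z, ⟨ha, hb⟩, Or.inl rfl, Or.inr ⟨h1, rfl⟩, rfl⟩,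
          ⟨a - 1, b, z, ⟨ha, hb⟩, Or.inr ⟨h0, rfl⟩, Or.inl rfl, rfl⟩,
          ⟨a - 1, b - 1, z, ⟨ha, hb⟩, Or.inr ⟨h0, rfl⟩, Or.inr ⟨h1, rfl⟩, rfl⟩]
    · simp only [h2, decide_false, if_false, Finset.mem_product, mem_grow, decide_eq_false_iff_not,
        not_false_eq_true, true_and, mem_towerCubes, Bool.false_eq_true, Finset.mem_union]
      constructor
      · rintro ⟨a', b', z', ⟨ha, hb⟩, ha', hb', rfl | rfl⟩ <;> simp at ha hb <;>
          rcases ha' with rfl | ⟨h0, rfl⟩ <;> rcases hb' with rfl | ⟨h1, rfl⟩ <;> simp [*]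
      · rintro (⟨ha, hb⟩ | ⟨ha, hb⟩) <;> rcases ha with ha | ⟨h0, ha⟩ <;>
          rcases hb with hb | ⟨h1, hb⟩
        exacts [⟨a, b, z, ⟨ha, hb⟩, Or.inl rfl, Or.inl rfl, Or.inl rfl⟩,
          ⟨a, b - 1, z, ⟨ha, hb⟩, Or.inl rfl, Or.inr ⟨h1, rfl⟩, Or.inl rfl⟩,
          ⟨a - 1, b, z, ⟨ha, hb⟩, Or.inr ⟨h0, rfl⟩, Or.inl rfl, Or.inl rfl⟩,
          ⟨a - 1, b - 1, z, ⟨ha, hb⟩, Or.inr ⟨h0, rfl⟩, Or.inr ⟨h1, rfl⟩, Or.inl rfl⟩,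
          ⟨a, b, z - 1, ⟨ha, hb⟩, Or.inl rfl, Or.inl rfl, Or.inr rfl⟩,
          ⟨a, b - 1, z - 1, ⟨ha, hb⟩, Or.inl rfl, Or.inr ⟨h1, rfl⟩, Or.inr rfl⟩,
          ⟨a - 1, b, z - 1, ⟨ha, hb⟩, Or.inr ⟨h0, rfl⟩, Or.inl rfl, Or.inr rfl⟩,
          ⟨a - 1, b - 1, z - 1, ⟨ha, hb⟩, Or.inr ⟨h0, rfl⟩, Or.inr ⟨h1, rfl⟩, Or.inr rfl⟩]
  have h2 : (∃ c, c ∉ towerCubes X Y ∧ cell ![a, b, z] D ⊆ cell c Finset.univ) ↔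
      (a, b) ∉ enclosed X Y (decide (0 ∈ D)) (decide (1 ∈ D)) (decide (2 ∈ D)) z := by
    rw [exists_cube_iff, ← not_iff_not, not_not]
    unfold enclosed
    constructor
    · intro h
      have key : ∀ a' b' z', (a' = a ∨ (0 ∉ D ∧ a' = a - 1)) → (b' = b ∨ (1 ∉ D ∧ b' = b - 1)) →
          (z' = z ∨ (2 ∉ D ∧ z' = z - 1)) → a' ∈ X z' ∧ b' ∈ Y z' := fun a' b' z' ha hb hz =>
        by_contra fun hn => h ⟨a', b', z', hn, ha, hb, hz⟩
      have hz : ∀ z', (z' = z ∨ (2 ∉ D ∧ z' = z - 1)) →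
          (a ∈ X z' ∧ (0 ∉ D → a - 1 ∈ X z')) ∧ (b ∈ Y z' ∧ (1 ∉ D → b - 1 ∈ Y z')) :=
        fun z' hz => ⟨⟨(key a b z' (Or.inl rfl) (Or.inl rfl) hz).1,
          fun h0 => (key (a - 1) b z' (Or.inr ⟨h0, rfl⟩) (Or.inl rfl) hz).1⟩,
          (key a b z' (Or.inl rfl) (Or.inl rfl) hz).2,
          fun h1 => (key a (b - 1) z' (Or.inl rfl) (Or.inr ⟨h1, rfl⟩) hz).2⟩
      have hz0 := hz z (Or.inl rfl)
      by_cases h2 : 2 ∈ D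
      · simpa [h2, mem_shrink] using hz0
      · have hz1 := hz (z - 1) (Or.inr ⟨h2, rfl⟩)
        simp only [h2, decide_false, Bool.false_eq_true, if_false, Finset.mem_inter,
          Finset.mem_product, mem_shrink, decide_eq_false_iff_not]
        exact ⟨hz0, hz1⟩
    · rintro h ⟨a', b', z', hn, ha, hb, hz⟩
      apply hn
      rw [mem_towerCubes]
      have hz' : (a ∈ X z' ∧ (0 ∉ D → a - 1 ∈ X z')) ∧ (b ∈ Y z' ∧ (1 ∉ D → b - 1 ∈ Y z')) := by
        by_cases h2 : 2 ∈ D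
        · simp only [h2, not_true_eq_false, false_and, or_false] at hz
          subst hz
          simpa [h2, mem_shrink] using h
        · simp only [h2, decide_false, Bool.false_eq_true, if_false, Finset.mem_inter,
            Finset.mem_product, mem_shrink, decide_eq_false_iff_not] at h
          rcases hz with rfl | ⟨-, rfl⟩
          exacts [h.1, h.2]
      refine ⟨?_, ?_⟩
      · rcases ha with rfl | ⟨h0, rfl⟩
        exacts [hz'.1.1, hz'.1.2 h0]
      · rcases hb with rfl | ⟨h1, rfl⟩
        exacts [hz'.2.1, hz'.2.2 h1]
  rw [Finset.mem_sdiff, ← h1, ← h2]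
  rfl

/-- Height `L` is included because the top of level `L - 1` lies there. -/
lemma ncard_mixed {L : ℤ} (hXY : ∀ z, ¬(0 ≤ z ∧ z < L) → X z = ∅ ∨ Y z = ∅)
    (D : Finset (Fin 3)) :
    ({p | Mixed (towerCubes X Y) p D}.ncard : ℤ) = ∑ z ∈ Finset.Icc 0 L,
      ((touching X Y (decide (0 ∈ D)) (decide (1 ∈ D)) (decide (2 ∈ D)) z \
        enclosed X Y (decide (0 ∈ D)) (decide (1 ∈ D)) (decide (2 ∈ D)) z).card : ℤ) := by
  rw [← Nat.cast_sum, ← Finset.card_sigma, ← Set.ncard_coe_finset,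
    ← Set.ncard_image_of_injective (f := fun x : (_ : ℤ) × (ℤ × ℤ) => ![x.2.1, x.2.2, x.1])]
  · congr 2
    ext p
    obtain ⟨a, b, z, rfl⟩ : ∃ x y z, p = ![x, y, z] :=
      ⟨p 0, p 1, p 2, by funext j; fin_cases j <;> rfl⟩
    simp only [Set.mem_ofPred_eq, Set.mem_image, Finset.mem_coe, Finset.mem_sigma]
    constructor
    · intro h
      refine ⟨⟨z, a, b⟩, ⟨?_, mixed_iff_mem_slice.1 h⟩, rfl⟩
      obtain ⟨⟨c, hc, hpc⟩, -⟩ := h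
      have hc2 : 0 ≤ c 2 ∧ c 2 < L := by
        by_contra hcz
        rw [mem_towerCubes] at hc
        rcases hXY _ hcz with h | h <;> simp [h] at hc
      have := cell_subset_cube_iff.1 hpc 2
      simp at this
      rw [Finset.mem_Icc]
      simp only
      omega
    · rintro ⟨⟨z', a', b'⟩, ⟨-, h⟩, heq⟩
      have h0 : a' = a := congrFun heq 0
      have h1 : b' = b := congrFun heq 1
      have h2 : z' = z := congrFun heq 2
      subst h0 h1 h2
      exact mixed_iff_mem_slice.2 h
  · rintro ⟨z, a, b⟩ ⟨z', a', b'⟩ heq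
    have h0 : a = a' := congrFun heq 0
    have h1 : b = b' := congrFun heq 1
    have h2 : z = z' := congrFun heq 2
    rw [h0, h1, h2]

lemma card_slice_true (d₀ d₁ : Bool) (z : ℤ) :
    ((touching X Y d₀ d₁ true z \ enclosed X Y d₀ d₁ true z).card : ℤ) =
      (grow d₀ (X z)).card * (grow d₁ (Y z)).card -
        (shrink d₀ (X z)).card * (shrink d₁ (Y z)).card := by
  have hsub : enclosed X Y d₀ d₁ true z ⊆ touching X Y d₀ d₁ true z := by
    simp only [enclosed, touching, if_true]
    exact Finset.product_subset_product (shrink_subset_grow _ _) (shrink_subset_grow _ _)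
  rw [Finset.cast_card_sdiff hsub]
  simp only [enclosed, touching, if_true, Finset.card_product]
  push_cast
  rfl

lemma card_slice_false (hX : Nested X) (hY : Nested Y) (d₀ d₁ : Bool) (z : ℤ) :
    ((touching X Y d₀ d₁ false z \ enclosed X Y d₀ d₁ false z).card : ℤ) =
      (grow d₀ (X z)).card * (grow d₁ (Y z)).card +
        (grow d₀ (X (z - 1))).card * (grow d₁ (Y (z - 1))).card -
        (grow d₀ (X z ∩ X (z - 1))).card * (grow d₁ (Y z ∩ Y (z - 1))).card -
        (shrink d₀ (X z ∩ X (z - 1))).card * (shrink d₁ (Y z ∩ Y (z - 1))).card := by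
  have hsub : enclosed X Y d₀ d₁ false z ⊆ touching X Y d₀ d₁ false z := by
    simp only [enclosed, touching, Bool.false_eq_true, if_false]
    exact Finset.inter_subset_left.trans ((Finset.product_subset_product (shrink_subset_grow _ _)
      (shrink_subset_grow _ _)).trans Finset.subset_union_left)
  rw [Finset.cast_card_sdiff hsub]
  simp only [enclosed, touching, Bool.false_eq_true, if_false]
  have h := Finset.card_union_add_card_inter (grow d₀ (X z) ×ˢ grow d₁ (Y z))
    (grow d₀ (X (z - 1)) ×ˢ grow d₁ (Y (z - 1)))
  rw [Finset.product_inter_product, grow_inter _ (hX z), grow_inter _ (hY z)] at h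
  rw [Finset.product_inter_product, shrink_inter, shrink_inter]
  simp only [Finset.card_product] at h ⊢
  zify at h
  push_cast
  linarith

/-- The Euler characteristic of the surface of a tower. -/
lemma eulerChar_towerCubes (hX : Nested X) (hY : Nested Y) (hfin : (towerCubes X Y).Finite) {L : ℤ}
    (hXY : ∀ z, ¬(0 ≤ z ∧ z < L) → X z = ∅ ∨ Y z = ∅) :
    eulerChar (surfaceOf (towerCubes X Y)) = ∑ z ∈ Finset.Icc 0 L,
      ((numRuns (X z) : ℤ) * numRuns (Y z) + numRuns (X (z - 1)) * numRuns (Y (z - 1)) -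
        2 * (numRuns (X z ∩ X (z - 1)) * numRuns (Y z ∩ Y (z - 1)))) := by
  rw [eulerChar_surfaceOf hfin]
  simp only [ncard_mixed hXY, Fin.sum_univ_three, ← Finset.sum_add_distrib,
    ← Finset.sum_sub_distrib]
  refine Finset.sum_congr rfl fun z _ => ?_
  -- In the alternating sum over points and intervals of one axis, `grow` contributes the number of
  -- runs and `shrink` its negative. For products the signs of `shrink` cancel, so vertically
  -- extended cells contribute 0 in total, and for the others the overlap is subtracted twice, once
  -- from `touching` and once as `enclosed`.
  simp [card_slice_true, card_slice_false hX hY, card_grow_false, card_grow_true,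
    card_shrink_false, card_shrink_true]
  ring

end

/-! ### Configurations as alternating towers -/

lemma nested_levelX {n : ℤ} {A : ℤ → Finset ℤ} (hA : ∀ z, A z ⊆ Finset.Ico 0 n) :
    Nested (levelX n A) := by
  intro z
  by_cases h : Even z
  · right
    have h' : ¬Even (z - 1) := by simpa [Int.even_sub_one] using h
    simpa only [levelX, h, h', if_true, if_false] using hA z
  · left
    have h' : Even (z - 1) := by simpa [Int.even_sub_one] using h
    simpa only [levelX, h, h', if_true, if_false] using hA (z - 1)

lemma nested_levelY {n : ℤ} {A : ℤ → Finset ℤ} (hA : ∀ z, A z ⊆ Finset.Ico 0 n) :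
    Nested (levelY n A) := by
  intro z
  by_cases h : Even z
  · left
    have h' : ¬Even (z - 1) := by simpa [Int.even_sub_one] using h
    simpa only [levelY, h, h', if_true, if_false] using hA (z - 1)
  · right
    have h' : Even (z - 1) := by simpa [Int.even_sub_one] using h
    simpa only [levelY, h, h', if_true, if_false] using hA z

lemma finite_alternatingCubes {n : ℤ} {A : ℤ → Finset ℤ} (hA : ∀ z, A z ⊆ Finset.Ico 0 n) {L : ℤ}
    (hL : ∀ z, (A z).Nonempty → 0 ≤ z ∧ z < L) : (alternatingCubes n A).Finite := by
  refine (Set.finite_Icc (0 : Fin 3 → ℤ) ![n, n, L]).subset fun p hp => ?_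
  rw [mem_alternatingCubes] at hp
  have h1 := Finset.mem_Ico.1 (hA _ hp.1)
  have h2 := hL _ ⟨_, hp.1⟩
  have h3 : ∀ j, 0 ≤ p j ∧ p j ≤ (![n, n, L] : Fin 3 → ℤ) j := by
    rw [forall_axis (p 2)]
    have e1 : (![n, n, L] : Fin 3 → ℤ) (across (p 2)) = n := by
      unfold across
      split_ifs <;> rfl
    have e2 : (![n, n, L] : Fin 3 → ℤ) (along (p 2)) = n := by
      unfold along
      split_ifs <;> rfl
    have e3 : (![n, n, L] : Fin 3 → ℤ) 2 = L := rfl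
    rw [e1, e2, e3]
    omega
  exact ⟨fun j => (h3 j).1, fun j => (h3 j).2⟩

/-! ### Runs of the levels, and configurations in terms of lattice cubes -/

lemma numRuns_empty : numRuns ∅ = 0 := by simp [numRuns]

lemma numRuns_eq_one {B : Finset ℤ} (hne : B.Nonempty)
    (hB : ∀ a ∈ B, ∀ b ∈ B, ∀ m, a ≤ m → m ≤ b → m ∈ B) : numRuns B = 1 := by
  rw [numRuns, Finset.card_eq_one]
  refine ⟨B.max' hne, Finset.ext fun a => ?_⟩
  rw [Finset.mem_filter, Finset.mem_singleton]
  constructor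
  · rintro ⟨ha, ha'⟩
    by_contra h
    have hlt : a < B.max' hne := lt_of_le_of_ne (B.le_max' a ha) h
    exact ha' (hB a ha _ (B.max'_mem hne) _ (by omega) (by omega))
  · rintro rfl
    refine ⟨B.max'_mem hne, fun h => ?_⟩
    have := B.le_max' _ h
    omega

lemma numRuns_Ico {n : ℤ} (hn : 0 < n) : numRuns (Finset.Ico 0 n) = 1 :=
  numRuns_eq_one ⟨0, by simpa using hn⟩ fun a ha b hb m _ _ => by
    rw [Finset.mem_Ico] at *
    omega

lemma numRuns_levels_mul {n : ℤ} (hn : 0 < n) (A : ℤ → Finset ℤ) (z : ℤ) :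
    (numRuns (levelX n A z) : ℤ) * numRuns (levelY n A z) = numRuns (A z) := by
  by_cases h : Even z <;> simp [levelX, levelY, h, numRuns_Ico hn]

/-- Of two consecutive shadows on an axis one is all of `[0, n)`, so the overlap of the levels is
the product of `A z` and `A (z - 1)`, one on each axis. -/
lemma numRuns_inter_mul {n : ℤ} {A : ℤ → Finset ℤ} (hA : ∀ z, A z ⊆ Finset.Ico 0 n) (z : ℤ) :
    (numRuns (levelX n A z ∩ levelX n A (z - 1)) : ℤ) *
      numRuns (levelY n A z ∩ levelY n A (z - 1)) = numRuns (A z) * numRuns (A (z - 1)) := by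
  by_cases h : Even z
  · have h' : ¬Even (z - 1) := by simpa [Int.even_sub_one] using h
    simp only [levelX, levelY, h, h', if_true, if_false]
    rw [Finset.inter_eq_left.2 (hA z), Finset.inter_eq_right.2 (hA (z - 1))]
  · have h' : Even (z - 1) := by simpa [Int.even_sub_one] using h
    simp only [levelX, levelY, h, h', if_true, if_false]
    rw [Finset.inter_eq_left.2 (hA z), Finset.inter_eq_right.2 (hA (z - 1)), mul_comm]

variable {n : ℕ} (c : Configuration n)

/-- The boxes with blocks in level `z`, as a set of integers. -/
noncomputable def Configuration.boxes (z : ℤ) : Finset ℤ :=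
  if h : 0 ≤ z ∧ z < c.numLevels then (c.level ⟨z.toNat, by omega⟩).image fun j : Fin n => (j : ℤ)
  else ∅

lemma Configuration.boxes_natCast (s : Fin c.numLevels) :
    c.boxes (s : ℕ) = (c.level s).image fun j : Fin n => (j : ℤ) := by
  have h : (0 : ℤ) ≤ (s : ℕ) ∧ ((s : ℕ) : ℤ) < c.numLevels := by
    have := s.2
    omega
  simp [boxes, h]

lemma Configuration.boxes_eq_empty {z : ℤ} (h : ¬(0 ≤ z ∧ z < c.numLevels)) : c.boxes z = ∅ := by
  simp only [boxes, h, dif_neg, not_false_eq_true]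

lemma Configuration.exists_level {z : ℤ} (h : 0 ≤ z ∧ z < c.numLevels) :
    ∃ s : Fin c.numLevels, z = (s : ℕ) :=
  ⟨⟨z.toNat, by omega⟩, by simp [h.1]⟩

lemma Configuration.boxes_subset (z : ℤ) : c.boxes z ⊆ Finset.Ico 0 (n : ℤ) := by
  by_cases h : 0 ≤ z ∧ z < c.numLevels
  · obtain ⟨s, rfl⟩ := c.exists_level h
    rw [c.boxes_natCast]
    intro a ha
    obtain ⟨j, -, rfl⟩ := Finset.mem_image.1 ha
    simp
  · simp [c.boxes_eq_empty h]

lemma block_eq_levelBox (n s j : ℕ) : block n s j = levelBox s j (j + 1) 0 n s (s + 1) := by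
  unfold block levelBox across along
  by_cases h : Even s
  · have h' : Even (s : ℤ) := by exact_mod_cast h
    simp [h, h']
  · have h' : ¬Even (s : ℤ) := by exact_mod_cast h
    simp only [h, h', if_false]
    ext x
    simp
    tauto

lemma Configuration.solid_eq (hn : 0 < n) :
    c.solid = solidOf (alternatingCubes n c.boxes) := by
  ext x
  simp only [Configuration.solid, Set.mem_iUnion, mem_solidOf, block_eq_levelBox]
  constructor
  · rintro ⟨s, j, hj, h1, ⟨h2, h3⟩, h4⟩
    obtain ⟨b, hb, hb', hb1, hb2⟩ := exists_int_near (by exact_mod_cast hn) h2 h3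
    refine ⟨levelPoint (s : ℕ) j b (s : ℕ), levelPoint_mem.2 ⟨?_, hb, hb'⟩, ?_⟩
    · rw [c.boxes_natCast]
      exact Finset.mem_image_of_mem _ hj
    · rw [cell_levelPoint]
      exact ⟨h1, ⟨hb1, by push_cast; exact hb2⟩, h4⟩
  · rintro ⟨p, hp, hx⟩
    obtain ⟨z, a, b, rfl⟩ : ∃ z a b, p = levelPoint z a b z := ⟨_, _, _, eq_levelPoint (p 2) p⟩
    obtain ⟨ha, hb, hb'⟩ := levelPoint_mem.1 hp
    rw [cell_levelPoint] at hx
    by_cases h : 0 ≤ z ∧ z < c.numLevels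
    · obtain ⟨s, rfl⟩ := c.exists_level h
      rw [c.boxes_natCast] at ha
      obtain ⟨j, hj, rfl⟩ := Finset.mem_image.1 ha
      obtain ⟨h1, ⟨h2, h3⟩, h4⟩ := hx
      have hb0 : (0 : ℝ) ≤ b := by exact_mod_cast hb
      have hbn : ((b + 1 : ℤ) : ℝ) ≤ ((n : ℤ) : ℝ) := by exact_mod_cast Int.add_one_le_iff.2 hb'
      exact ⟨s, j, hj, h1, ⟨by push_cast; exact hb0.trans h2, h3.trans hbn⟩, h4⟩
    · simp [c.boxes_eq_empty h] at ha

lemma Configuration.surface_eq (hn : 0 < n) :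
    c.surface = surfaceOf (alternatingCubes n c.boxes) := by
  unfold Configuration.surface surfaceOf
  rw [c.solid_eq hn]

lemma Configuration.card_boxes (s : Fin c.numLevels) :
    (c.boxes (s : ℕ)).card = (c.level s).card := by
  rw [c.boxes_natCast]
  exact Finset.card_image_of_injective _ fun i j h => by
    simp only [Nat.cast_inj] at h
    exact Fin.ext h

lemma numRuns_of_gapped {s : Fin c.numLevels} (h : Gapped (c.level s)) :
    numRuns (c.boxes (s : ℕ)) = (c.level s).card := by
  rw [← c.card_boxes, numRuns, Finset.filter_true_of_mem]
  intro a ha ha'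
  rw [c.boxes_natCast] at ha ha'
  obtain ⟨i, hi, rfl⟩ := Finset.mem_image.1 ha
  obtain ⟨j, hj, hij⟩ := Finset.mem_image.1 ha'
  obtain ⟨m, him, hmj, -⟩ := h i hi j hj (by rw [Fin.lt_def]; omega)
  rw [Fin.lt_def] at him hmj
  omega

lemma numRuns_of_withoutGaps {s : Fin c.numLevels} (hne : (c.level s).Nonempty)
    (h : WithoutGaps (c.level s)) : numRuns (c.boxes (s : ℕ)) = 1 := by
  rw [c.boxes_natCast]
  refine numRuns_eq_one (hne.image _) ?_
  rintro a ha b hb m ham hmb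
  obtain ⟨i, hi, rfl⟩ := Finset.mem_image.1 ha
  obtain ⟨j, hj, rfl⟩ := Finset.mem_image.1 hb
  have hj2 := j.2
  obtain ⟨t, rfl⟩ := Int.eq_ofNat_of_zero_le (show 0 ≤ m by omega)
  have ht : t < n := by omega
  have hmem : (⟨t, ht⟩ : Fin n) ∈ (c.level s : Set (Fin n)) :=
    h.out hi hj ⟨Fin.le_def.2 (by exact_mod_cast ham), Fin.le_def.2 (by exact_mod_cast hmb)⟩
  exact Finset.mem_image.2 ⟨⟨t, ht⟩, hmem, rfl⟩

variable {c} {k : ℕ}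

lemma Configuration.IsEvenNK.numRuns_rest (hc : c.IsEvenNK k) {s : ℕ} (hs : s + 2 < 2 * k - 1) :
    numRuns (c.boxes s) = n / 2 := by
  have h := hc.numLevels_eq
  have := hc.rest ⟨s, by omega⟩ (by simp only; omega)
  rw [← this.1]
  exact numRuns_of_gapped c (s := ⟨s, by omega⟩) this.2

lemma Configuration.IsEvenNK.numRuns_second (hc : c.IsEvenNK k) (hn : 0 < n) {s : ℕ}
    (hs : s + 2 = 2 * k - 1) : numRuns (c.boxes s) = 1 := by
  have h := hc.numLevels_eq
  have h1 := hc.second ⟨s, by omega⟩ (by simp only; omega)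
  have h2 : c.level ⟨s, by omega⟩ = Finset.univ := by
    rw [← Finset.card_eq_iff_eq_univ, h1, Fintype.card_fin]
  refine numRuns_of_withoutGaps c (s := ⟨s, by omega⟩) (Finset.card_pos.1 (by omega)) ?_
  rw [WithoutGaps, h2, Finset.coe_univ]
  exact Set.ordConnected_univ

lemma Configuration.IsEvenNK.numRuns_top (hc : c.IsEvenNK k) (hn : 2 ≤ n) {s : ℕ}
    (hs : s + 1 = 2 * k - 1) : numRuns (c.boxes s) = 1 := by
  have h := hc.numLevels_eq
  have h1 := hc.top ⟨s, by omega⟩ (by simp only; omega)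
  exact numRuns_of_withoutGaps c (s := ⟨s, by omega⟩) (Finset.card_pos.1 (by omega)) h1.2

lemma Configuration.IsEvenNK.boxes_nonempty_iff (hc : c.IsEvenNK k) (hn : 2 ≤ n) (z : ℤ) :
    (c.boxes z).Nonempty ↔ 0 ≤ z ∧ z < c.numLevels := by
  constructor
  · intro h
    by_contra h'
    simp [c.boxes_eq_empty h'] at h
  · intro h
    obtain ⟨s, rfl⟩ := c.exists_level h
    rw [← Finset.card_pos, c.card_boxes]
    have hs := s.2
    rcases lt_trichotomy ((s : ℕ) + 2) c.numLevels with h | h | h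
    · have := (hc.rest s h).1
      omega
    · have := hc.second s h
      omega
    · have := (hc.top s (by omega)).1
      omega

lemma sum_Icc_int_eq_sum_range (f : ℤ → ℤ) (L : ℕ) :
    ∑ z ∈ Finset.Icc 0 (L : ℤ), f z = ∑ i ∈ Finset.range (L + 1), f i := by
  have h : Finset.Icc 0 (L : ℤ) = (Finset.range (L + 1)).image fun i : ℕ => (i : ℤ) := by
    ext z
    simp only [Finset.mem_Icc, Finset.mem_image, Finset.mem_range]
    constructor
    · exact fun h => ⟨z.toNat, by omega, by omega⟩
    · rintro ⟨i, hi, rfl⟩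
      omega
  rw [h, Finset.sum_image fun i _ j _ hij => by simpa using hij]

lemma Configuration.IsEvenNK.eulerChar_surface (hc : c.IsEvenNK k) (hn : 2 ≤ n) (hk : 2 ≤ k) :
    eulerChar c.surface = 2 + (2 * (k : ℤ) - 4) * (2 * (n / 2 : ℕ) - 2 * (n / 2 : ℕ) ^ 2) := by
  have hL := hc.numLevels_eq
  have hnpos : 0 < n := by omega
  have hsub := c.boxes_subset
  have hne := hc.boxes_nonempty_iff hn
  -- Outside the tower one of the two shadows is still `[0, n)`; only the other is empty.
  have hempty : ∀ z, ¬(0 ≤ z ∧ z < (c.numLevels : ℤ)) →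
      levelX n c.boxes z = ∅ ∨ levelY n c.boxes z = ∅ := by
    intro z hz
    by_cases h : Even z <;> simp [levelX, levelY, h, c.boxes_eq_empty hz]
  rw [c.surface_eq hnpos, eulerChar_towerCubes (nested_levelX hsub) (nested_levelY hsub)
    (finite_alternatingCubes hsub fun z => (hne z).1) hempty]
  simp only [numRuns_levels_mul (n := (n : ℤ)) (by exact_mod_cast hnpos), numRuns_inter_mul hsub]
  rw [sum_Icc_int_eq_sum_range, hL]
  obtain ⟨l, rfl⟩ : ∃ l, k = l + 2 := ⟨k - 2, by omega⟩
  -- The heights are `0, …, 2l + 3`. With m = n/2, height 0 gives m, each of the next 2l heights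
  -- gives 2m - 2m², and the last three give 1 - m, 0 and 1.
  have e : 2 * (l + 2) - 1 + 1 = 2 * l + 1 + 1 + 1 + 1 := by omega
  have hrest : ∀ s : ℕ, s < 2 * l + 1 → numRuns (c.boxes s) = n / 2 :=
    fun s hs => hc.numRuns_rest (by omega)
  have hsecond : numRuns (c.boxes (2 * l + 1 : ℕ)) = 1 := hc.numRuns_second hnpos (by omega)
  have htop : numRuns (c.boxes (2 * l + 1 + 1 : ℕ)) = 1 := hc.numRuns_top hn (by omega)
  have habove : numRuns (c.boxes (2 * l + 1 + 1 + 1 : ℕ)) = 0 := by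
    rw [c.boxes_eq_empty (by omega), numRuns_empty]
  have hbelow : numRuns (c.boxes (((0 : ℕ) : ℤ) - 1)) = 0 := by
    rw [c.boxes_eq_empty (by omega), numRuns_empty]
  have hpred : ∀ s : ℕ, ((s + 1 : ℕ) : ℤ) - 1 = s := fun s => by push_cast; ring
  rw [e, Finset.sum_range_succ, Finset.sum_range_succ, Finset.sum_range_succ,
    Finset.sum_range_succ', hbelow, hpred, hpred, hpred, hsecond, htop, habove,
    hrest 0 (by omega), hrest (2 * l) (by omega)]
  have hconst : ∀ i ∈ Finset.range (2 * l), ((numRuns (c.boxes ((i + 1 : ℕ) : ℤ)) : ℤ) +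
      numRuns (c.boxes (((i + 1 : ℕ) : ℤ) - 1)) - 2 * (numRuns (c.boxes ((i + 1 : ℕ) : ℤ)) *
        numRuns (c.boxes (((i + 1 : ℕ) : ℤ) - 1)))) =
      2 * (n / 2 : ℕ) - 2 * (n / 2 : ℕ) ^ 2 := by
    intro i hi
    rw [Finset.mem_range] at hi
    rw [hpred, hrest i (by omega), hrest (i + 1) (by omega)]
    ring
  rw [Finset.sum_congr rfl hconst, Finset.sum_const, Finset.card_range]
  simp only [nsmul_eq_mul]
  push_cast
  ring

end Jenga

theorem mainTheorem2 (n k : ℕ) (hn : Even n) (hn1 : 1 < n) (hk : 2 ≤ k)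
    (c : Jenga.Configuration n) (hc : c.IsEvenNK k) :
    Jenga.IsPolyhedralClosedSurface c.surface ∧
    ⋃₀ c.surface = frontier c.solid ∧
    IsConnected (frontier c.solid) ∧
    Jenga.genus c.surface = (n : ℚ) * ((n : ℚ) - 2) * ((k : ℚ) - 2) / 2 := by
  have hnpos : 0 < n := by omega
  have hsub := c.boxes_subset
  have hne := hc.boxes_nonempty_iff hn1
  refine ⟨?_, ?_, ?_, ?_⟩
  · rw [c.surface_eq hnpos]
    exact Jenga.isPolyhedralClosedSurface_towerCubes (Jenga.nested_levelX hsub)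
      (Jenga.nested_levelY hsub) (Jenga.finite_alternatingCubes hsub fun z => (hne z).1)
  · rw [c.surface_eq hnpos, c.solid_eq hnpos, Jenga.sUnion_surfaceOf]
  · rw [c.solid_eq hnpos]
    refine Jenga.isConnected_frontier_alternating (by exact_mod_cast hnpos)
      (fun z a ha => Finset.mem_Ico.1 (hsub z ha)) (L := c.numLevels) ?_ hne
    have := hc.numLevels_eq
    omega
  · obtain ⟨m, rfl⟩ := hn
    rw [Jenga.genus, hc.eulerChar_surface hn1 hk]
    have : (m + m) / 2 = m := by omega
    rw [this]
    push_cast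
    ring
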